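/- **Theorem 4.1 (Hilbert algebra bundles).** Let $X$ be a paracompact Hausdorff space, let $H$ be an infinite-dimensional separable complex Hilbert space, let $\mathcal L(H)$ be the algebra of bounded operators on $H$, let $U(H)$ be its unitary group with the topology of the operator norm, and let $PU(H)=U(H)/S^1$, which acts on $\mathcal L(H)$ by inner automorphisms. Let $\mathcal U=(U_i)_{i\in I}$ be a good covering of $X$: an open covering with $I$ finite such that every intersection of finitely many (at least one) members of $\mathcal U$ is empty or contractible. Let $\lambda=(\lambda_{kji})$, with $\lambda_{kji}:U_i\cap U_j\cap U_k\to S^1$ continuous, be a completely normalized 2-cocycle: $\lambda_{lkj}\lambda_{lji}=\lambda_{kji}\lambda_{lki}$, $\lambda_{kji}=1$ if two indices are equal, and a permutation of the three indices changes $\lambda$ by the power $\pm1$ given by its signature. A bundle of algebras with fibre $\mathcal L(H)$ means a locally trivial bundle of algebras with structural group $PU(H)$, given by transition functions, which are $PU(H)$-valued 1-cocycles on some open covering of $X$; isomorphisms are those of such bundles. It is called associated to $\lambda$ if its class in $H^1(X;PU(H))$ is sent to the class of $\lambda$ by the coboundary map $H^1(X;PU(H))\to H^2(X;S^1)$ of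 Čech cohomology, that is, if on some common refinement of the two coverings its transition functions lift to continuous $U(H)$-valued functions $g_{sr}$ for which the 2-cocycle $g_{ts}\,g_{sr}\,g_{tr}^{-1}$ is cohomologous to the restriction of $\lambda$. A $\lambda$-twisted Hilbert bundle $E$ on $\mathcal U$ with fibre $H$ is a family of continuous maps $g_{ji}:U_i\cap U_j\to U(H)$ with $g_{ii}=1$, $g_{ji}=(g_{ij})^{-1}$ and $g_{kj}\,g_{ji}=g_{ki}\,\lambda_{kji}$ over $U_i\cap U_j\cap U_k$; and $\mathrm{END}(E)$ is the bundle of algebras with fibre $\mathcal L(H)$ whose transition functions on $\mathcal U$ are $f\mapsto g_{ji}\circ f\circ (g_{ji})^{-1}$. Then there is a bundle of algebras $\underline{\mathcal L}_\lambda$ with fibre $\mathcal L(H)$ associated to $\lambda$, it is unique up to isomorphism, and it may be written as $\mathrm{END}(E)$: for every bundle of algebras $A$ with fibre $\mathcal L(H)$ associated to $\lambda$ there is a $\lambda$-twisted Hilbert bundle $E$ on $\mathcal U$ such that $A$ is isomorphic to $\mathrm{END}(E)$. -/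

import Mathlib

universe u v w y

namespace TwistedHilbert

/-! ### Open coverings -/

/-- A family of open subsets of `X` covering `X`. -/
structure IsOpenCovering {X : Type u} [TopologicalSpace X] {ι : Type v} (U : ι → Set X) :
    Prop where
  isOpen : ∀ i, IsOpen (U i)
  covers : ∀ x, ∃ i, x ∈ U i

/-- A good covering: an open covering with finitely many members, all of whose intersections
`U i₁ ∩ ⋯ ∩ U iₙ` (`n ≥ 1`) are either empty or contractible. -/
structure IsGoodCovering {X : Type u} [TopologicalSpace X] {ι : Type v} (U : ι → Set X) : Prop
    extends IsOpenCovering U where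
  finite : Finite ι
  contractible : ∀ s : Finset ι, s.Nonempty → (⋂ i ∈ s, U i).Nonempty →
    ContractibleSpace (⋂ i ∈ s, U i : Set X)

/-- A completely normalized 2-cocycle `lam k j i : U i ∩ U j ∩ U k → S¹` of the covering `U` with
values in the circle. Only the values on the triple intersections are meaningful. -/
structure NormalizedCocycle {X : Type u} [TopologicalSpace X] {ι : Type v} (U : ι → Set X) where
  toFun : ι → ι → ι → X → Circle
  continuousOn : ∀ k j i, ContinuousOn (toFun k j i) (U i ∩ U j ∩ U k)
  cocycle : ∀ l k j i, ∀ x ∈ U i ∩ U j ∩ U k ∩ U l,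
    toFun l k j x * toFun l j i x = toFun k j i x * toFun l k i x
  eq_one_left : ∀ j i, ∀ x ∈ U i ∩ U j, toFun j j i x = 1
  eq_one_right : ∀ k i, ∀ x ∈ U i ∩ U k, toFun k i i x = 1
  eq_one_outer : ∀ k j, ∀ x ∈ U j ∩ U k, toFun k j k x = 1
  /-- The two adjacent transpositions generate the permutations of the three indices, so the two
  following conditions say that a permutation acts through its signature. -/
  swap_left : ∀ k j i, ∀ x ∈ U i ∩ U j ∩ U k, toFun j k i x = (toFun k j i x)⁻¹
  swap_right : ∀ k j i, ∀ x ∈ U i ∩ U j ∩ U k, toFun k i j x = (toFun k j i x)⁻¹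

/-! ### The groups `U(H)` and `PU(H)` -/

section Groups

variable (H : Type w) [NormedAddCommGroup H] [InnerProductSpace ℂ H] [CompleteSpace H]

/-- The unitary group `U(H)`, with the topology of the operator norm. -/
abbrev UnitaryGroup : Type w := unitary (H →L[ℂ] H)

/-- The group of automorphisms of the (star) algebra `𝓛(H)`. -/
abbrev AlgAut : Type w := (H →L[ℂ] H) ≃⋆ₐ[ℂ] (H →L[ℂ] H)

/-- The inclusion `S¹ → U(H)` as scalar operators. -/
noncomputable def scalar : Circle →* UnitaryGroup H where
  toFun z := ⟨(z : ℂ) • (1 : H →L[ℂ] H), by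
    have h1 : (starRingEnd ℂ) (z : ℂ) * (z : ℂ) = 1 := by
      rw [mul_comm, Complex.mul_conj, Circle.normSq_coe, Complex.ofReal_one]
    have h2 : (z : ℂ) * (starRingEnd ℂ) (z : ℂ) = 1 := by rw [mul_comm]; exact h1
    rw [Unitary.mem_iff]
    constructor <;> simp [smul_smul, h1, h2]⟩
  map_one' := by ext; simp
  map_mul' a b := by ext; simp [smul_smul, mul_comm]

theorem scalar_mul_comm (z : Circle) (g : UnitaryGroup H) :
    g * scalar H z = scalar H z * g := by
  ext; simp [scalar]

instance scalar_range_normal : (scalar H).range.Normal where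
  conj_mem := by
    rintro _ ⟨z, rfl⟩ g
    exact ⟨z, by rw [scalar_mul_comm, mul_inv_cancel_right]⟩

/-- The projective unitary group `PU(H) = U(H) / S¹`, with the quotient topology. -/
abbrev PU : Type w := UnitaryGroup H ⧸ (scalar H).range

/-- The unitary `g` acts on `𝓛(H)` by the inner automorphism `f ↦ g ∘ f ∘ g⁻¹`. -/
noncomputable def conj : UnitaryGroup H →* AlgAut H :=
  Unitary.conjStarAlgAut ℂ (H →L[ℂ] H)

theorem conj_apply (g : UnitaryGroup H) (f : H →L[ℂ] H) :
    conj H g f = (g : H →L[ℂ] H) * f * ((g⁻¹ : UnitaryGroup H) : H →L[ℂ] H) := rfl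

/-- The action of `PU(H)` on `𝓛(H)` induced by `conj`. -/
noncomputable def PU.ad : PU H →* AlgAut H :=
  QuotientGroup.lift (scalar H).range (conj H) (by
    rintro _ ⟨z, rfl⟩
    rw [MonoidHom.mem_ker]
    refine StarAlgEquiv.ext fun f => ?_
    have h : (scalar H z : H →L[ℂ] H) * f = f * (scalar H z : H →L[ℂ] H) := by
      ext; simp [scalar]
    rw [conj_apply, h, mul_assoc, ← Submonoid.coe_mul, mul_inv_cancel]
    simp)

end Groups

/-- A family `α x` (`x ∈ s`) of automorphisms of `𝓛(H)` that is a continuous map from `s` to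
`PU(H)`, acting on `𝓛(H)` by inner automorphisms. -/
def ContinuousInPU {X : Type u} [TopologicalSpace X] {H : Type w} [NormedAddCommGroup H]
    [InnerProductSpace ℂ H] [CompleteSpace H] (s : Set X) (α : X → AlgAut H) : Prop :=
  ∃ γ : X → PU H, ContinuousOn γ s ∧ ∀ x ∈ s, α x = PU.ad H (γ x)

/-! ### Algebra bundles -/

/-- A bundle of algebras over `X` with fibre `𝓛(H)` and structural group `PU(H)` acting by inner
automorphisms, as a coordinate bundle: an open covering together with transition functions
`trans b a x : 𝓛(H) → 𝓛(H)` from the chart `a` to the chart `b`. -/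
structure AlgebraBundle (X : Type u) [TopologicalSpace X] (H : Type w) [NormedAddCommGroup H]
    [InnerProductSpace ℂ H] [CompleteSpace H] where
  Index : Type v
  base : Index → Set X
  covering : IsOpenCovering base
  trans : Index → Index → X → AlgAut H
  continuousInPU : ∀ b a, ContinuousInPU (base a ∩ base b) (trans b a)
  cocycle : ∀ c b a, ∀ x ∈ base a ∩ base b ∩ base c, trans c b x * trans b a x = trans c a x

/-- Two algebra bundles, possibly described on different coverings, are isomorphic: there are
algebra isomorphisms `θ b a x` of the fibre `𝓛(H)`, given by continuous maps to `PU(H)`, from the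
chart `a` of `A` to the chart `b` of `B`, compatible with the transition functions. -/
def AlgebraBundle.Isomorphic {X : Type u} [TopologicalSpace X] {H : Type w}
    [NormedAddCommGroup H] [InnerProductSpace ℂ H] [CompleteSpace H]
    (A : AlgebraBundle.{u, v, w} X H) (B : AlgebraBundle.{u, y, w} X H) : Prop :=
  ∃ θ : B.Index → A.Index → X → AlgAut H,
    (∀ b a, ContinuousInPU (A.base a ∩ B.base b) (θ b a)) ∧
    ∀ b' b a' a, ∀ x ∈ A.base a ∩ A.base a' ∩ (B.base b ∩ B.base b'),
      θ b' a' x * A.trans a' a x = B.trans b' b x * θ b a x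

/-- The algebra bundle `A` is associated to the 2-cocycle `lam`: its class in the Čech cohomology
`H¹(X; PU(H))` is sent to the class of `lam` by the coboundary map `H¹(X; PU(H)) → H²(X; S¹)`.
Explicitly, on some common refinement `V` of the covering of `A` and of `U`, the transition
functions of `A` lift to continuous maps `g t s` with values in `U(H)`, and the 2-cocycle
`g t s * g s r * (g t r)⁻¹` with values in `S¹` is cohomologous to the restriction of `lam`. -/
def AlgebraBundle.IsAssociatedTo {X : Type u} [TopologicalSpace X] {H : Type w}
    [NormedAddCommGroup H] [InnerProductSpace ℂ H] [CompleteSpace H]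
    (A : AlgebraBundle.{u, y, w} X H) {ι : Type v} {U : ι → Set X}
    (lam : NormalizedCocycle U) : Prop :=
  ∃ (S : Type u) (V : S → Set X) (τ : S → ι) (σ : S → A.Index)
    (g : S → S → X → UnitaryGroup H) (η : S → S → X → Circle),
    IsOpenCovering V ∧ (∀ s, V s ⊆ U (τ s)) ∧ (∀ s, V s ⊆ A.base (σ s)) ∧
    (∀ s r, ContinuousOn (g s r) (V r ∩ V s)) ∧
    (∀ s r, ContinuousOn (η s r) (V r ∩ V s)) ∧
    (∀ s r, ∀ x ∈ V r ∩ V s, A.trans (σ s) (σ r) x = conj H (g s r x)) ∧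
    ∀ t s r, ∀ x ∈ V r ∩ V s ∩ V t,
      g t s x * g s r x * (g t r x)⁻¹ =
        scalar H (lam.toFun (τ t) (τ s) (τ r) x * (η s r x * (η t r x)⁻¹ * η t s x))

/-! ### Twisted Hilbert bundles -/

/-- A `lam`-twisted Hilbert bundle with fibre `H` on the covering `U`. -/
structure TwistedHilbertBundle {X : Type u} [TopologicalSpace X] {ι : Type v} {U : ι → Set X}
    (lam : NormalizedCocycle U) (H : Type w) [NormedAddCommGroup H] [InnerProductSpace ℂ H]
    [CompleteSpace H] where
  g : ι → ι → X → UnitaryGroup H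
  continuousOn : ∀ j i, ContinuousOn (g j i) (U i ∩ U j)
  self : ∀ i, ∀ x ∈ U i, g i i x = 1
  symm : ∀ j i, ∀ x ∈ U i ∩ U j, g j i x = (g i j x)⁻¹
  twisted : ∀ k j i, ∀ x ∈ U i ∩ U j ∩ U k,
    g k j x * g j i x = g k i x * scalar H (lam.toFun k j i x)

/-- The algebra bundle `END(E)` of a twisted Hilbert bundle `E`: over `U i ∩ U j` its transition
functions are `f ↦ g j i ∘ f ∘ (g j i)⁻¹`. -/
noncomputable def TwistedHilbertBundle.END {X : Type u} [TopologicalSpace X] {ι : Type v}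
    {U : ι → Set X} (hU : IsOpenCovering U) {lam : NormalizedCocycle U} {H : Type w}
    [NormedAddCommGroup H] [InnerProductSpace ℂ H] [CompleteSpace H]
    (E : TwistedHilbertBundle lam H) : AlgebraBundle.{u, v, w} X H where
  Index := ι
  base := U
  covering := hU
  trans j i x := conj H (E.g j i x)
  continuousInPU j i := ⟨fun x => (E.g j i x : PU H),
    continuous_quotient_mk'.comp_continuousOn (E.continuousOn j i), fun _ _ => rfl⟩
  cocycle k j i x hx := by
    have h : conj H (scalar H (lam.toFun k j i x)) = 1 :=
      (congrArg (PU.ad H) ((QuotientGroup.eq_one_iff _).2 ⟨_, rfl⟩)).trans (map_one _)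
    rw [← map_mul, E.twisted k j i x hx, map_mul, h, mul_one]

end TwistedHilbert

/-!
Three facts about `U(H)` and its bundles carry the proof.

*Kuiper's theorem* (`homotopic_one`): a map from a compact space to `U(H)`, with the norm topology,
is null-homotopic. In the Banach algebra of continuous families of operators, `nullUnits` is the
normal subgroup of the units joined to `1`. Compactness provides an isometry `v` whose range the
family almost moves off the range of a second isometry; modulo `nullUnits` the family then becomes
the identity on the range of `v` and splits off on the complement (`exists_fixing_mod_nullUnits`).
By the Wold decomposition of `v`, infinitely many orthogonal copies of that complement fit into `H`,
so that the remaining family is a commutator with a shift (`exists_commutator`), and the shift is a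
product of two involutions, which lie in `nullUnits`. The unitary part of the polar decomposition
turns the path of units into a homotopy in `U(H)`.

*Triviality over contractible sets* (`exists_trivialization`): a Hilbert bundle given by a unitary
cocycle embeds, by a partition of unity, into a trivial bundle as the image of a continuous family
of projections, and such a family over a contractible base is conjugate to a constant one
(`exists_intertwiner`).

*Twisted bundles on the nerve* (`exists_isomorphism`): isomorphisms between two `lam`-twisted
Hilbert bundles are constructed over the skeleta of the nerve of the covering. Extending over a
face amounts to extending a map to `U(H)` from the boundary of a simplex times a contractible set
`U i₁ ∩ ⋯ ∩ U iₙ`, which Kuiper's theorem allows since the boundary is compact. A partition of unity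
pulls the result back to `X`.

An algebra bundle associated to `lam` becomes untwisted over each `U i`, hence trivial there, and
comparing these trivializations writes it as `END(E)` (`exists_isomorphic_END`). Uniqueness follows,
since any two twisted bundles are isomorphic. For existence (`exists_associated`) a twisted
cocycle is built on a shrinking of the covering, adding one member at a time: over the new member
the cocycle found so far is untwisted and then trivialized. Keeping the ranges of all maps in
compact sets makes Kuiper's theorem applicable to the cut-offs that this requires.
-/

namespace TwistedHilbert

open Set Filter Topology
open scoped Pointwise

/-! ### The unitary part of an invertible element -/

section Polar

variable {A : Type*} [CStarAlgebra A] [PartialOrder A] [StarOrderedRing A]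

theorem isUnit_sqrt_mul_star (a : Aˣ) : IsUnit (CFC.sqrt ((a : A) * star (a : A))) :=
  (CFC.isUnit_sqrt_iff _ (mul_star_self_nonneg _)).2 (a.isUnit.mul a.isUnit.star)

/-- The unitary factor `(a a⋆)^{-1/2} a` of the polar decomposition of an invertible element. -/
noncomputable def unitaryPart (a : Aˣ) : unitary A :=
  ⟨Ring.inverse (CFC.sqrt ((a : A) * star (a : A))) * a, by
    have hu := isUnit_sqrt_mul_star a
    set r := CFC.sqrt ((a : A) * star (a : A)) with hr
    have hs : star r = r := (IsSelfAdjoint.of_nonneg (CFC.sqrt_nonneg _)).star_eq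
    have hrr : r * r = (a : A) * star (a : A) :=
      CFC.sqrt_mul_sqrt_self _ (mul_star_self_nonneg _)
    have hsi : star (Ring.inverse r) = Ring.inverse r := by rw [← Ring.inverse_star, hs]
    have h1 : Ring.inverse r * (a : A) * star (Ring.inverse r * (a : A)) = 1 := by
      rw [star_mul, hsi, mul_assoc, ← mul_assoc (a : A), ← hrr, mul_assoc r,
        Ring.mul_inverse_cancel r hu, mul_one, Ring.inverse_mul_cancel r hu]
    have hU : IsUnit (Ring.inverse r * (a : A)) := hu.ringInverse.mul a.isUnit
    refine Unitary.mem_iff.2 ⟨?_, h1⟩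
    obtain ⟨c, hc⟩ := hU
    rw [← hc] at h1 ⊢
    rw [← Units.inv_eq_of_mul_eq_one_right h1]
    exact c.inv_mul⟩

theorem unitaryPart_mul (a : Aˣ) (g : unitary A) :
    unitaryPart (a * Unitary.toUnits g) = unitaryPart a * g := by
  have h : ((a * Unitary.toUnits g : Aˣ) : A) * star ((a * Unitary.toUnits g : Aˣ) : A)
      = (a : A) * star (a : A) := by
    simp only [Units.val_mul, star_mul, Unitary.val_toUnits_apply]
    rw [mul_assoc, ← mul_assoc (g : A), Unitary.mul_star_self_of_mem g.2, one_mul]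
  ext
  change Ring.inverse (CFC.sqrt (((a * Unitary.toUnits g : Aˣ) : A) *
    star ((a * Unitary.toUnits g : Aˣ) : A))) * _ =
      Ring.inverse (CFC.sqrt ((a : A) * star (a : A))) * (a : A) * g
  rw [h, Units.val_mul, Unitary.val_toUnits_apply, mul_assoc]

theorem unitaryPart_toUnits (g : unitary A) : unitaryPart (Unitary.toUnits g) = g := by
  ext
  simp [unitaryPart]

theorem continuous_unitaryPart : Continuous (unitaryPart : Aˣ → unitary A) := by
  refine Continuous.subtype_mk (Continuous.mul ?_ Units.continuous_val) _
  have h1 : Continuous fun a : Aˣ => (a : A) * star (a : A) :=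
    Units.continuous_val.mul (continuous_star.comp Units.continuous_val)
  have h2 : Continuous fun a : Aˣ => CFC.sqrt ((a : A) * star (a : A)) :=
    CFC.continuousOn_sqrt.comp_continuous h1 fun a => mul_star_self_nonneg _
  refine continuous_iff_continuousAt.2 fun a => ?_
  obtain ⟨c, hc⟩ := isUnit_sqrt_mul_star a
  have h3 := NormedRing.inverse_continuousAt c
  rw [hc] at h3
  exact ContinuousAt.comp (f := fun a : Aˣ => CFC.sqrt ((a : A) * star (a : A))) h3
    h2.continuousAt

end Polar

/-! ### Units joined to `1` in a Banach algebra -/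

section Joined

variable (A : Type*) [NormedRing A]

/-- The path component of `1` in the group of units of a Banach algebra. -/
def nullUnits : Subgroup Aˣ where
  carrier := {a | Joined 1 a}
  one_mem' := Joined.refl 1
  mul_mem' {a b} ha hb := by simpa using ha.mul hb
  inv_mem' {a} ha := by simpa using ha.inv

variable {A}

instance nullUnits_normal : (nullUnits A).Normal where
  conj_mem a ha g := by
    have := ((Joined.refl g).mul ha).mul (Joined.refl g⁻¹)
    simpa [nullUnits] using this

section Complete

variable [CompleteSpace A]

/-- A continuous map with invertible values is continuous as a map to the group of units. -/
theorem exists_continuous_units {Y : Type*} [TopologicalSpace Y] (c : Y → A) (hc : Continuous c)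
    (hu : ∀ t, IsUnit (c t)) : ∃ d : Y → Aˣ, Continuous d ∧ ∀ t, (d t : A) = c t := by
  choose d hd using hu
  refine ⟨d, Units.continuous_iff.2 ⟨hc.congr fun t => (hd t).symm, ?_⟩, hd⟩
  refine continuous_iff_continuousAt.2 fun t => ?_
  have h := NormedRing.inverse_continuousAt (d t)
  rw [hd t] at h
  have h' := ContinuousAt.comp (f := c) h hc.continuousAt
  exact h'.congr (Eventually.of_forall fun s => by simp [← hd s])

/-- A unit is joined to `1` as soon as it can be reached from `1` through invertible elements
along a continuous curve. -/
theorem mem_nullUnits_of_path (c : unitInterval → A) (hc : Continuous c) (hu : ∀ t, IsUnit (c t))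
    (h0 : c 0 = 1) (a : Aˣ) (h1 : c 1 = a) : a ∈ nullUnits A := by
  obtain ⟨d, hd', hd⟩ := exists_continuous_units c hc hu
  exact ⟨⟨⟨d, hd'⟩, Units.ext (by simp [hd, h0]), Units.ext (by simp [hd, h1])⟩⟩

variable [NormedAlgebra ℂ A]

/-- An involution `s` is joined to `1`, along `(1 + s)/2 + z (1 - s)/2` for `z` on a half circle
from `1` to `-1`. -/
theorem involution_mem_nullUnits (s : Aˣ) (hs : (s : A) * s = 1) : s ∈ nullUnits A := by
  set p : A := (1 / 2 : ℂ) • (1 + (s : A)) with hp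
  set q : A := (1 / 2 : ℂ) • (1 - (s : A)) with hq
  have hpq : p * q = 0 := by
    simp only [hp, hq, smul_mul_smul_comm, mul_sub, add_mul, one_mul, mul_one, hs]; module
  have hqp : q * p = 0 := by
    simp only [hp, hq, smul_mul_smul_comm, mul_add, sub_mul, one_mul, mul_one, hs]; module
  have hpp : p * p = p := by
    simp only [hp, smul_mul_smul_comm, mul_add, add_mul, one_mul, mul_one, hs]; module
  have hqq : q * q = q := by
    simp only [hq, smul_mul_smul_comm, mul_sub, sub_mul, one_mul, mul_one, hs]; module
  have h1 : p + q = 1 := by simp only [hp, hq]; module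
  have h2 : p - q = s := by simp only [hp, hq]; module
  have hmul : ∀ z z' : ℂ, z * z' = 1 → (p + z • q) * (p + z' • q) = 1 := fun z z' h => by
    simp only [mul_add, add_mul, smul_mul_assoc, mul_smul_comm, hpq, hqp, hpp, hqq, smul_zero,
      add_zero, zero_add]
    rw [smul_smul, mul_comm z' z, h, one_smul, h1]
  let e : unitInterval → ℂ := fun t => Complex.exp ((t : ℝ) * (Real.pi * Complex.I))
  have he : Continuous e := by fun_prop
  refine mem_nullUnits_of_path (fun t => p + e t • q) (by fun_prop) (fun t => ?_) ?_ s ?_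
  · exact ⟨⟨_, p + (e t)⁻¹ • q, hmul _ _ (mul_inv_cancel₀ (Complex.exp_ne_zero _)),
      hmul _ _ (inv_mul_cancel₀ (Complex.exp_ne_zero _))⟩, rfl⟩
  · simp [e, h1]
  · simp [e, Complex.exp_pi_mul_I, ← h2, sub_eq_add_neg]

theorem one_sub_mem_nullUnits (b : A) (hb : ‖b‖ < 1) (a : Aˣ) (ha : (a : A) = 1 - b) :
    a ∈ nullUnits A := by
  refine mem_nullUnits_of_path (fun t => 1 - (t : ℝ) • b) (by fun_prop) (fun t => ?_) (by simp) a
    (by simp [ha])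
  refine (Units.oneSub ((t : ℝ) • b) (lt_of_le_of_lt ?_ hb)).isUnit
  rw [norm_smul, Real.norm_of_nonneg t.2.1]
  exact mul_le_of_le_one_left (norm_nonneg _) t.2.2

theorem one_sub_mem_nullUnits_of_mul_self (b : A) (hb : b * b = 0) (a : Aˣ)
    (ha : (a : A) = 1 - b) : a ∈ nullUnits A := by
  refine mem_nullUnits_of_path (fun t => 1 - (t : ℝ) • b) (by fun_prop) (fun t => ?_) (by simp) a
    (by simp [ha])
  refine ⟨⟨1 - (t : ℝ) • b, 1 + (t : ℝ) • b, ?_, ?_⟩, rfl⟩ <;>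
    simp [mul_add, add_mul, sub_mul, mul_sub, hb]

/-- **Kuiper's first step.** Let `v`, `w` be isometries (with left inverses `v'`, `w'`) with
orthogonal ranges, and let `f` be a unit that almost moves the range of `v` off the range of `w`.
Up to units joined to `1`, `f` is the identity on the range of `v` and on its complement splits
off: `f v = v` and `v' f = v'`. -/
theorem exists_fixing_mod_nullUnits {v v' w w' : A} (hv : v' * v = 1) (hw : w' * w = 1)
    (hwv : w' * v = 0) (hvw : v' * w = 0) (f : Aˣ)
    (hf : ‖w * (w' * f * v) * v' * (f⁻¹ : Aˣ)‖ < 1) :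
    ∃ g : Aˣ, (g : A) * v = v ∧ v' * g = v' ∧ (g ∈ nullUnits A → f ∈ nullUnits A) := by
  set n₁ : Aˣ := Units.oneSub _ hf with hn₁
  have m₁ : n₁ ∈ nullUnits A := one_sub_mem_nullUnits _ hf _ rfl
  -- `f₁` is the perturbation of `f` that moves the range of `v` exactly off the range of `w`.
  set f₁ : Aˣ := n₁ * f with hf₁
  have e₁ : (f₁ : A) = f - w * (w' * f * v) * v' := by
    simp [hf₁, hn₁, sub_mul, mul_assoc]
  have o₁ : w' * f₁ * v = 0 := by
    rw [e₁]
    calc w' * (f - w * (w' * f * v) * v') * v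
        = w' * f * v - (w' * w) * (w' * f * v) * (v' * v) := by noncomm_ring
      _ = 0 := by rw [hv, hw]; simp
  set P : A := f₁ * v with hP
  set L : A := v' * (f₁⁻¹ : Aˣ) * (1 - w * w') with hL
  have o₁' : w' * P = 0 := by rw [hP, ← mul_assoc, o₁]
  have hLP : L * P = 1 := by
    calc L * P = v' * (f₁⁻¹ : Aˣ) * (P - w * (w' * P)) := by rw [hL]; noncomm_ring
      _ = v' * ((f₁⁻¹ : Aˣ) * f₁) * v := by rw [o₁', hP]; noncomm_ring
      _ = 1 := by simp [hv]
  have hLw : L * w = 0 := by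
    calc L * w = v' * (f₁⁻¹ : Aˣ) * (w - w * (w' * w)) := by rw [hL]; noncomm_ring
      _ = 0 := by rw [hw]; simp
  -- the involution that exchanges two embeddings with complementary ranges
  have swap : ∀ P L Q M : A, L * P = 1 → M * Q = 1 → M * P = 0 → L * Q = 0 →
      ∃ s ∈ nullUnits A, (s : A) * P = Q := fun P L Q M hLP hMQ hMP hLQ => by
    let σ : A := 1 - P * L - Q * M + Q * L + P * M
    have hσP : σ * P = Q := by
      calc σ * P = P - P * (L * P) - Q * (M * P) + Q * (L * P) + P * (M * P) := by
            simp only [σ]; noncomm_ring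
        _ = Q := by rw [hLP, hMP]; simp
    have hσQ : σ * Q = P := by
      calc σ * Q = Q - P * (L * Q) - Q * (M * Q) + Q * (L * Q) + P * (M * Q) := by
            simp only [σ]; noncomm_ring
        _ = P := by rw [hLQ, hMQ]; simp
    have hσ : σ * σ = 1 := by
      calc σ * σ = σ - (σ * P) * L - (σ * Q) * M + (σ * Q) * L + (σ * P) * M := by
            conv_lhs => rw [show σ = 1 - P * L - Q * M + Q * L + P * M from rfl]
            simp only [mul_add, mul_sub, mul_one, ← mul_assoc]
            rfl
        _ = 1 := by rw [hσP, hσQ]; simp only [σ]; noncomm_ring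
    exact ⟨⟨σ, σ, hσ, hσ⟩, involution_mem_nullUnits _ hσ, hσP⟩
  obtain ⟨s₁, ms₁, hs₁⟩ := swap P L w w' hLP hw o₁' hLw
  obtain ⟨s₂, ms₂, hs₂⟩ := swap w w' v v' hw hv hvw hwv
  set f₂ : Aˣ := s₂ * (s₁ * f₁) with hf₂
  have o₂ : (f₂ : A) * v = v := by
    rw [hf₂, Units.val_mul, Units.val_mul, mul_assoc, mul_assoc, ← hP, hs₁, hs₂]
  set b : A := v * v' * f₂ * (1 - v * v') with hb
  have hbv : b * v = 0 := by
    calc b * v = v * v' * f₂ * (v - v * (v' * v)) := by rw [hb]; noncomm_ring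
      _ = 0 := by rw [hv]; simp
  have hbb : b * b = 0 := by
    calc b * b = (b * v) * (v' * f₂ * (1 - v * v')) := by
          conv_lhs => rw [hb]
          rw [hb]; noncomm_ring
      _ = 0 := by rw [hbv, zero_mul]
  have hz : (1 - b) * (1 + b) = 1 ∧ (1 + b) * (1 - b) = 1 := by
    constructor <;> simp [mul_add, add_mul, sub_mul, mul_sub, hbb]
  set z : Aˣ := ⟨1 - b, 1 + b, hz.1, hz.2⟩
  have mz : z ∈ nullUnits A := one_sub_mem_nullUnits_of_mul_self b hbb _ rfl
  have zv : (z : A) * v = v := by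
    change (1 - b) * v = v
    rw [sub_mul, hbv]; simp
  refine ⟨f₂ * z, ?_, ?_, fun h => ?_⟩
  · rw [Units.val_mul, mul_assoc, zv, o₂]
  · have h1 : v' * f₂ * b = v' * f₂ * (1 - v * v') := by
      calc v' * f₂ * b = v' * (f₂ * v) * (v' * f₂ * (1 - v * v')) := by rw [hb]; noncomm_ring
        _ = _ := by rw [o₂, hv, one_mul]
    have h2 : v' * f₂ * (v * v') = v' := by
      calc v' * f₂ * (v * v') = v' * (f₂ * v) * v' := by noncomm_ring
        _ = _ := by rw [o₂, hv, one_mul]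
    change v' * (f₂ * (1 - b)) = v'
    rw [← mul_assoc, mul_sub, mul_one, h1, mul_sub, h2, mul_one]
    abel
  · have h' : f = n₁⁻¹ * (s₁⁻¹ * (s₂⁻¹ * ((f₂ * z) * z⁻¹))) := by
      simp [hf₂, hf₁]
    rw [h']
    exact mul_mem (inv_mem m₁) (mul_mem (inv_mem ms₁) (mul_mem (inv_mem ms₂)
      (mul_mem h (inv_mem mz))))

end Complete

end Joined

/-! ### Isometries that a finite set of operators separates -/

section Isometries

variable {H : Type*} [NormedAddCommGroup H] [InnerProductSpace ℂ H]

local notation "⟪" x ", " y "⟫" => inner ℂ x y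

theorem exists_unit_orthogonal (hH : ¬ FiniteDimensional ℂ H) (F : Finset H) :
    ∃ a : H, ‖a‖ = 1 ∧ ∀ x ∈ F, ⟪x, a⟫ = 0 := by
  have hne : (Submodule.span ℂ (F : Set H))ᗮ ≠ ⊥ := fun h => by
    have hfin : FiniteDimensional ℂ (Submodule.span ℂ (F : Set H)) :=
      FiniteDimensional.span_finset ℂ F
    rw [Submodule.orthogonal_eq_bot_iff] at h
    rw [h] at hfin
    exact hH (Module.finite_def.2 (Module.Finite.iff_fg.1 hfin))
  obtain ⟨z, hz, hz0⟩ := Submodule.exists_mem_ne_zero_of_ne_bot hne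
  refine ⟨((‖z‖ : ℂ)⁻¹) • z, ?_, fun x hx => ?_⟩
  · rw [norm_smul, norm_inv, Complex.norm_real, norm_norm, inv_mul_cancel₀ (norm_ne_zero_iff.2 hz0)]
  · rw [inner_smul_right, (Submodule.mem_orthogonal _ _).1 hz x (Submodule.subset_span hx),
      mul_zero]

theorem Orthonormal.countable [TopologicalSpace.SeparableSpace H] {ι : Type*} {b : ι → H}
    (hb : Orthonormal ℂ b) : Countable ι := by
  have hd : ∀ i j, i ≠ j → 1 < dist (b i) (b j) := fun i j hij => by
    have h1 : ‖b i - b j‖ * ‖b i - b j‖ = 2 := by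
      rw [← sq, @norm_sub_sq ℂ, hb.2 hij, hb.1, hb.1]; norm_num
    rw [dist_eq_norm]
    nlinarith [norm_nonneg (b i - b j)]
  refine Pairwise.countable_of_isOpen_disjoint (s := fun i => Metric.ball (b i) (1 / 2))
    (fun i j hij => ?_) (fun i => Metric.isOpen_ball) fun i => ⟨b i, by simp⟩
  exact Metric.ball_disjoint_ball (by linarith [hd i j hij])

variable [CompleteSpace H]

/-- A bounded functional vanishing on an orthonormal family vanishes on the isometric image of
`ℓ²` that the family spans. -/
theorem linearIsometry_mem_ker {ι : Type*} {a : ι → H} (ha : Orthonormal ℂ a) (L : H →L[ℂ] ℂ)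
    (hL : ∀ i, L (a i) = 0) (x : lp (fun _ : ι => ℂ) 2) :
    L (ha.orthogonalFamily.linearIsometry x) = 0 := by
  have h := (ha.orthogonalFamily.hasSum_linearIsometry x).mapL L
  refine h.unique ?_
  simp [hL, hasSum_zero]

/-- In an infinite-dimensional separable Hilbert space, finitely many operators can be compressed
to zero between the ranges of two isometries. -/
theorem exists_isometries (hH : ¬ FiniteDimensional ℂ H) [TopologicalSpace.SeparableSpace H]
    (s : Finset (H →L[ℂ] H)) :
    ∃ v w : H →L[ℂ] H, star v * v = 1 ∧ star w * w = 1 ∧ ∀ g ∈ s, star w * g * v = 0 := by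
  classical
  -- orthonormal sequences `a n`, `b n` with `b m` orthogonal to all `g (a n)`, chosen alternately
  obtain ⟨f, hP, hr⟩ := exists_seq_of_forall_finset_exists
    (fun p : H × H => ‖p.1‖ = 1 ∧ ‖p.2‖ = 1 ∧ ∀ g ∈ s, ⟪p.2, g p.1⟫ = 0)
    (fun p q => ⟪p.1, q.1⟫ = 0 ∧ ⟪p.2, q.2⟫ = 0 ∧
      ∀ g ∈ s, ⟪q.2, g p.1⟫ = 0 ∧ ⟪p.2, g q.1⟫ = 0) (fun S _ => by
        obtain ⟨a, ha, ha'⟩ := exists_unit_orthogonal hH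
          (S.image Prod.fst ∪ (s ×ˢ S).image fun r => ContinuousLinearMap.adjoint r.1 r.2.2)
        obtain ⟨b, hb, hb'⟩ := exists_unit_orthogonal hH
          (S.image Prod.snd ∪ (s ×ˢ S).image (fun r => r.1 r.2.1) ∪ s.image fun g => g a)
        refine ⟨(a, b), ⟨ha, hb, fun g hg => ?_⟩, fun p hp => ⟨?_, ?_, fun g hg => ⟨?_, ?_⟩⟩⟩
        · exact inner_eq_zero_symm.1 (hb' _ (by
            simp only [Finset.mem_union, Finset.mem_image]; exact Or.inr ⟨g, hg, rfl⟩))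
        · exact ha' _ (by
            simp only [Finset.mem_union, Finset.mem_image]; exact Or.inl ⟨p, hp, rfl⟩)
        · exact hb' _ (by
            simp only [Finset.mem_union, Finset.mem_image]; exact Or.inl (Or.inl ⟨p, hp, rfl⟩))
        · refine inner_eq_zero_symm.1 (hb' _ ?_)
          simp only [Finset.mem_union, Finset.mem_image]
          exact Or.inl (Or.inr ⟨(g, p), Finset.mem_product.2 ⟨hg, hp⟩, rfl⟩)
        · rw [← ContinuousLinearMap.adjoint_inner_left]
          refine ha' _ ?_
          simp only [Finset.mem_union, Finset.mem_image]
          exact Or.inr ⟨(g, p), Finset.mem_product.2 ⟨hg, hp⟩, rfl⟩)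
  have hg : ∀ g ∈ s, ∀ m n, ⟪(f m).2, g (f n).1⟫ = 0 := fun g hg m n => by
    rcases lt_trichotomy m n with h | rfl | h
    · exact ((hr m n h).2.2 g hg).2
    · exact (hP m).2.2 g hg
    · exact ((hr n m h).2.2 g hg).1
  obtain ⟨ι, e, -⟩ := exists_hilbertBasis ℂ H
  have : Countable ι := Orthonormal.countable e.orthonormal
  obtain ⟨k, hk⟩ := exists_injective_nat ι
  have hne : ∀ i j : ι, i ≠ j → k i < k j ∨ k j < k i := fun i j hij =>
    lt_or_gt_of_ne (hk.ne hij)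
  have ha : Orthonormal ℂ fun i => (f (k i)).1 := ⟨fun i => (hP _).1, fun i j hij => by
    rcases hne i j hij with h | h
    · exact (hr _ _ h).1
    · exact inner_eq_zero_symm.1 (hr _ _ h).1⟩
  have hb : Orthonormal ℂ fun i => (f (k i)).2 := ⟨fun i => (hP _).2.1, fun i j hij => by
    rcases hne i j hij with h | h
    · exact (hr _ _ h).2.1
    · exact inner_eq_zero_symm.1 (hr _ _ h).2.1⟩
  set v : H →ₗᵢ[ℂ] H := ha.orthogonalFamily.linearIsometry.comp e.repr.toLinearIsometry
  set w : H →ₗᵢ[ℂ] H := hb.orthogonalFamily.linearIsometry.comp e.repr.toLinearIsometry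
  have hiso : ∀ v : H →ₗᵢ[ℂ] H,
      star v.toContinuousLinearMap * v.toContinuousLinearMap = 1 := fun v => by
    refine ContinuousLinearMap.ext fun x => ext_inner_left ℂ fun z => ?_
    change ⟪z, ContinuousLinearMap.adjoint v.toContinuousLinearMap (v x)⟫ = ⟪z, x⟫
    rw [ContinuousLinearMap.adjoint_inner_right]
    exact v.inner_map_map z x
  refine ⟨v.toContinuousLinearMap, w.toContinuousLinearMap, hiso v, hiso w, fun g hgs => ?_⟩
  refine ContinuousLinearMap.ext fun x => ext_inner_left ℂ fun z => ?_
  change ⟪z, ContinuousLinearMap.adjoint w.toContinuousLinearMap (g (v x))⟫ = ⟪z, 0⟫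
  rw [ContinuousLinearMap.adjoint_inner_right, inner_zero_right]
  have h1 : ∀ i, ⟪(f (k i)).2, g (v x)⟫ = 0 := fun i =>
    linearIsometry_mem_ker ha ((innerSL ℂ (f (k i)).2).comp g)
      (fun j => hg g hgs _ _) (e.repr x)
  refine inner_eq_zero_symm.1 ?_
  exact linearIsometry_mem_ker hb (innerSL ℂ (g (v x)))
      (fun j => inner_eq_zero_symm.1 (h1 j)) (e.repr z)

end Isometries

/-! ### The swindle -/

/-- **The swindle.** Suppose `D x` is the commutator of `D' x` with a product `σ₁ σ₀` of two
involutions. Since involutions are joined to `1`, so is `D x`. -/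
theorem commutator_mem_nullUnits {A B : Type*} [NormedRing A] [NormedRing B] [NormedAlgebra ℂ B]
    [CompleteSpace B] (D D' : A →* B) (hD : Continuous D) (hD' : Continuous D') (σ₀ σ₁ : B)
    (h₀ : σ₀ * σ₀ = 1) (h₁ : σ₁ * σ₁ = 1) (h : ∀ x, D x * (σ₁ * σ₀ * D' x) = D' x * (σ₁ * σ₀))
    {Y : Type*} [TopologicalSpace Y] [CompactSpace Y] (x : C(Y, A)ˣ) :
    Units.map (D.compLeftContinuous Y hD) x ∈ nullUnits C(Y, B) := by
  let s : ∀ σ : B, σ * σ = 1 → C(Y, B)ˣ := fun σ hσ =>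
    ⟨ContinuousMap.const Y σ, ContinuousMap.const Y σ,
      ContinuousMap.ext fun _ => hσ, ContinuousMap.ext fun _ => hσ⟩
  have hs : ∀ σ hσ, s σ hσ ∈ nullUnits C(Y, B) := fun σ hσ =>
    involution_mem_nullUnits _ (ContinuousMap.ext fun _ => hσ)
  set d := Units.map (D'.compLeftContinuous Y hD') x
  set T := s σ₁ h₁ * s σ₀ h₀ with hT
  have key : Units.map (D.compLeftContinuous Y hD) x * (T * d) = d * T :=
    Units.ext (ContinuousMap.ext fun y => h (x.1 y))
  have key' : Units.map (D.compLeftContinuous Y hD) x = (d * T * d⁻¹) * T⁻¹ := by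
    rw [← key]; group
  have hT : T ∈ nullUnits C(Y, B) := mul_mem (hs _ h₁) (hs _ h₀)
  rw [key']
  exact mul_mem (nullUnits_normal.conj_mem _ hT d) (inv_mem hT)

section Swindle

variable {K : Type*} [NormedAddCommGroup K] [InnerProductSpace ℂ K]

/-- The operator `(y n) ↦ (b n (y (π n)))` on `ℓ²(ℤ, K)`, for a permutation `π` and a bounded
family of operators `b`. -/
theorem exists_monomial (π : Equiv.Perm ℤ) (b : ℤ → K →L[ℂ] K) (C : ℝ) (hC : ∀ n, ‖b n‖ ≤ C) :
    ∃ T : lp (fun _ : ℤ => K) 2 →L[ℂ] lp (fun _ : ℤ => K) 2,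
      (∀ x n, T x n = b n (x (π n))) ∧ ‖T‖ ≤ C := by
  have h2 : (2 : ENNReal).toReal = (2 : ℝ) := rfl
  have hC0 : 0 ≤ C := (norm_nonneg _).trans (hC 0)
  have hle : ∀ (x : lp (fun _ : ℤ => K) 2) n,
      ‖b n (x (π n))‖ ^ (2 : ENNReal).toReal ≤ C ^ 2 * ‖x (π n)‖ ^ (2 : ENNReal).toReal :=
    fun x n => by
      rw [h2, Real.rpow_two, Real.rpow_two, ← mul_pow]
      exact pow_le_pow_left₀ (norm_nonneg _)
        (((b n).le_opNorm _).trans (mul_le_mul_of_nonneg_right (hC n) (norm_nonneg _))) 2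
  have hsum : ∀ x : lp (fun _ : ℤ => K) 2,
      HasSum (fun n => C ^ 2 * ‖x (π n)‖ ^ (2 : ENNReal).toReal)
        (C ^ 2 * ‖x‖ ^ (2 : ENNReal).toReal) := fun x =>
    (π.hasSum_iff.2 (lp.hasSum_norm (by norm_num) x)).mul_left _
  have hs : ∀ x : lp (fun _ : ℤ => K) 2,
      Summable fun n => ‖b n (x (π n))‖ ^ (2 : ENNReal).toReal := fun x =>
    Summable.of_nonneg_of_le (fun n => by positivity) (hle x) (hsum x).summable
  let T₀ : lp (fun _ : ℤ => K) 2 →ₗ[ℂ] lp (fun _ : ℤ => K) 2 :=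
    { toFun := fun x => ⟨fun n => b n (x (π n)), memℓp_gen (hs x)⟩
      map_add' := fun x z => by ext n; exact (b n).map_add _ _
      map_smul' := fun c x => by ext n; exact (b n).map_smul _ _ }
  refine ⟨T₀.mkContinuous C fun x => ?_, fun x n => rfl, T₀.mkContinuous_norm_le hC0 _⟩
  refine lp.norm_le_of_tsum_le (by norm_num) (by positivity) ?_
  calc ∑' n, ‖b n (x (π n))‖ ^ (2 : ENNReal).toReal
      ≤ C ^ 2 * ‖x‖ ^ (2 : ENNReal).toReal :=
        ((hs x).tsum_le_tsum (hle x) (hsum x).summable).trans_eq (hsum x).tsum_eq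
    _ = (C * ‖x‖) ^ (2 : ENNReal).toReal := by
        rw [h2, Real.rpow_two, Real.rpow_two, mul_pow]

open Classical in
/-- The operator that acts as `x` on the coordinates in `E` and as the identity on the others,
multiplicative and continuous in `x`. -/
theorem exists_blockDiagonal (E : Set ℤ) :
    ∃ D : (K →L[ℂ] K) →* (lp (fun _ : ℤ => K) 2 →L[ℂ] lp (fun _ : ℤ => K) 2), Continuous D ∧
      ∀ x z n, D x z n = if n ∈ E then x (z n) else z n := by
  choose D hD hDn using fun x : K →L[ℂ] K => exists_monomial 1 (fun n => if n ∈ E then x else 1)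
    (max ‖x‖ ‖(1 : K →L[ℂ] K)‖) (fun n => by split_ifs <;> simp)
  have hD' : ∀ x z n, D x z n = if n ∈ E then x (z n) else z n := fun x z n => by
    rw [hD]; split_ifs <;> simp
  refine ⟨{ toFun := D, map_one' := ?_, map_mul' := fun x x' => ?_ }, ?_, hD'⟩
  · ext z n; rw [hD']; split_ifs <;> simp
  · ext z n
    change D (x * x') z n = D x (D x' z) n
    rw [hD', hD', hD']; split_ifs <;> rfl
  · change Continuous D
    have hL : ∀ x x', dist (D x) (D x') ≤ dist x x' := fun x x' => by
      obtain ⟨T, hT, hTn⟩ := exists_monomial 1 (fun n => if n ∈ E then x - x' else 0)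
        ‖x - x'‖ (fun n => by split_ifs <;> simp)
      have : D x - D x' = T := by
        ext z n
        change D x z n - D x' z n = T z n
        rw [hD', hD', hT]
        split_ifs <;> simp
      calc dist (D x) (D x') = ‖D x - D x'‖ := by exact dist_eq_norm (D x) (D x')
        _ ≤ ‖x - x'‖ := by rw [this]; exact hTn
        _ = dist x x' := (dist_eq_norm _ _).symm
    exact (LipschitzWith.mk_one hL).continuous

variable {H : Type*} [NormedAddCommGroup H] [InnerProductSpace ℂ H] [CompleteSpace H]

/-- The commutator presentation of an operator acting on one coordinate of `ℓ²(ℤ, K)`: it is the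
commutator of the same operator on all coordinates `n ≥ 0` with the bilateral shift, and the shift
is the product of the reflections `n ↦ -n` and `n ↦ 1 - n`. -/
theorem exists_commutator (K : Type*) [NormedAddCommGroup K] [InnerProductSpace ℂ K] :
    ∃ (D D' : (K →L[ℂ] K) →* (lp (fun _ : ℤ => K) 2 →L[ℂ] lp (fun _ : ℤ => K) 2))
      (σ₀ σ₁ : lp (fun _ : ℤ => K) 2 →L[ℂ] lp (fun _ : ℤ => K) 2),
      Continuous D ∧ Continuous D' ∧ σ₀ * σ₀ = 1 ∧ σ₁ * σ₁ = 1 ∧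
      (∀ x, D x * (σ₁ * σ₀ * D' x) = D' x * (σ₁ * σ₀)) ∧
      ∀ x z n, D x z n = if n = 0 then x (z n) else z n := by
  obtain ⟨D, hDc, hD⟩ := exists_blockDiagonal (K := K) {0}
  obtain ⟨D', hDc', hD'⟩ := exists_blockDiagonal (K := K) {n | 0 ≤ n}
  choose σ hσ _ using fun k : ℤ => exists_monomial (Equiv.subLeft k) (fun _ => (1 : K →L[ℂ] K))
    ‖(1 : K →L[ℂ] K)‖ (fun n => le_rfl)
  have hσσ : ∀ k, σ k * σ k = 1 := fun k => by
    ext z n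
    change σ k (σ k z) n = z n
    simp [hσ]
  refine ⟨D, D', σ 0, σ 1, hDc, hDc', hσσ 0, hσσ 1, fun x => ?_, fun x z n => ?_⟩
  · ext z n
    change D x (σ 1 (σ 0 (D' x z))) n = D' x (σ 1 (σ 0 z)) n
    rw [hD, hD']
    simp only [hσ, hD', Equiv.subLeft_apply, mem_ofPred_eq, mem_singleton_iff,
      one_apply_eq_self]
    by_cases h0 : n = 0
    · subst h0; simp
    · rw [if_neg h0]
      have : (0 : ℤ) ≤ 0 - (1 - n) ↔ 1 ≤ n := by omega
      have h1 : 0 ≤ n ↔ 1 ≤ n := by omega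
      simp only [this, h1]
  · rw [hD]; simp

/-- The powers of an isometry `v` map the orthogonal complement of its range onto pairwise
orthogonal subspaces (the Wold decomposition). They assemble to an isometry of `ℓ²(ℤ, K)` into `H`
which is the inclusion of `K` on the coordinate `0`. -/
theorem exists_wold (v : H →L[ℂ] H) (hv : star v * v = 1) :
    ∃ J : lp (fun _ : ℤ => (LinearMap.range v.toLinearMap)ᗮ) 2 →ₗᵢ[ℂ] H,
      ∀ x, J (lp.single 2 0 x) = x := by
  have hvi : ∀ x z, inner ℂ (v x) (v z) = inner ℂ x z := fun x z => by
    rw [← ContinuousLinearMap.adjoint_inner_right]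
    change inner ℂ x ((star v * v) z) = _
    rw [hv]; rfl
  have hpow : ∀ (n : ℕ) x z, inner ℂ ((v ^ n) x) ((v ^ n) z) = inner ℂ x z := fun n => by
    induction n with
    | zero => intro x z; rfl
    | succ n ih => intro x z; rw [pow_succ']; exact (hvi _ _).trans (ih x z)
  let e : ℤ ≃ ℕ := Equiv.intEquivNat
  let V : ∀ _ : ℤ, (LinearMap.range v.toLinearMap)ᗮ →ₗᵢ[ℂ] H := fun n =>
    ((v ^ e n).toLinearMap.comp (Submodule.subtype _)).isometryOfInner fun x z => hpow _ _ _
  have horth : ∀ a b : ℕ, a < b → ∀ x z : (LinearMap.range v.toLinearMap)ᗮ,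
      inner ℂ ((v ^ a) (x : H)) ((v ^ b) (z : H)) = 0 := fun a b hab x z => by
    obtain ⟨c, rfl⟩ := Nat.exists_eq_add_of_lt hab
    have : (v ^ (a + c + 1)) (z : H) = (v ^ a) (v ((v ^ c) (z : H))) := by
      rw [add_assoc, pow_add, pow_succ']; rfl
    rw [this, hpow]
    exact (Submodule.mem_orthogonal' _ _).1 x.2 _ ⟨_, rfl⟩
  have hV : OrthogonalFamily ℂ (fun _ : ℤ => (LinearMap.range v.toLinearMap)ᗮ) V :=
    fun m n hmn x z => by
      rcases lt_or_gt_of_ne (e.injective.ne hmn) with h | h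
      · exact horth _ _ h x z
      · exact inner_eq_zero_symm.1 (horth _ _ h z x)
  refine ⟨hV.linearIsometry, fun x => ?_⟩
  rw [hV.linearIsometry_apply_single]
  rfl

/-- The operator on `H` that acts as `d` on the range of an isometry `j : E → H` and as the identity
on the orthogonal complement of that range. -/
noncomputable def corner {E : Type*} [NormedAddCommGroup E] [InnerProductSpace ℂ E]
    [CompleteSpace E] (j : E →L[ℂ] H) (hj : ∀ x, ContinuousLinearMap.adjoint j (j x) = x) :
    (E →L[ℂ] E) →* (H →L[ℂ] H) where
  toFun d := 1 + j.comp ((d - 1).comp (ContinuousLinearMap.adjoint j))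
  map_one' := by simp
  map_mul' d d' := by
    ext x
    change x + j (d (d' (ContinuousLinearMap.adjoint j x)) - ContinuousLinearMap.adjoint j x) =
      (x + j (d' (ContinuousLinearMap.adjoint j x) - ContinuousLinearMap.adjoint j x)) +
      j (d (ContinuousLinearMap.adjoint j
        (x + j (d' (ContinuousLinearMap.adjoint j x) - ContinuousLinearMap.adjoint j x))) -
        (ContinuousLinearMap.adjoint j
        (x + j (d' (ContinuousLinearMap.adjoint j x) - ContinuousLinearMap.adjoint j x))))
    simp only [map_add, map_sub, hj]
    abel

theorem continuous_corner {E : Type*} [NormedAddCommGroup E] [InnerProductSpace ℂ E]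
    [CompleteSpace E] (j : E →L[ℂ] H) (hj : ∀ x, ContinuousLinearMap.adjoint j (j x) = x) :
    Continuous (corner j hj) := by
  change Continuous fun d : E →L[ℂ] E => 1 + j.comp ((d - 1).comp (ContinuousLinearMap.adjoint j))
  fun_prop

theorem LinearIsometry.adjoint_apply_self {E : Type*} [NormedAddCommGroup E]
    [InnerProductSpace ℂ E] [CompleteSpace E] (j : E →ₗᵢ[ℂ] H) (x : E) :
    ContinuousLinearMap.adjoint j.toContinuousLinearMap (j x) = x :=
  ext_inner_left ℂ fun z => by
    rw [ContinuousLinearMap.adjoint_inner_right]; exact j.inner_map_map z x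

/-- A continuous family of invertible operators that is the identity on the range of an isometry
`v` and splits off on the complement `K` of that range is joined to `1`, provided that infinitely
many orthogonal copies of `K` fit into `H`. -/
theorem mem_nullUnits_of_wold {Y : Type*} [TopologicalSpace Y] [CompactSpace Y]
    {K : Type*} [NormedAddCommGroup K] [InnerProductSpace ℂ K] [CompleteSpace K]
    (v : H →L[ℂ] H) (hv : star v * v = 1) (j : K →ₗᵢ[ℂ] H)
    (hjj : ∀ x, j (ContinuousLinearMap.adjoint j.toContinuousLinearMap x) = x - v (star v x))
    (J : lp (fun _ : ℤ => K) 2 →ₗᵢ[ℂ] H) (hJ : ∀ x, J (lp.single 2 0 x) = j x)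
    (g : C(Y, H →L[ℂ] H)ˣ)
    (h₁ : (g : C(Y, H →L[ℂ] H)) * ContinuousMap.const Y v = ContinuousMap.const Y v)
    (h₂ : ContinuousMap.const Y (star v) * (g : C(Y, H →L[ℂ] H)) =
      ContinuousMap.const Y (star v)) :
    g ∈ nullUnits C(Y, H →L[ℂ] H) := by
  obtain ⟨D, D', σ₀, σ₁, hDc, hDc', hσ₀, hσ₁, hcomm, hD⟩ := exists_commutator K
  have hj := LinearIsometry.adjoint_apply_self j
  have hJ' := LinearIsometry.adjoint_apply_self J
  let jc := j.toContinuousLinearMap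
  let Jc := J.toContinuousLinearMap
  have hv' : ∀ x, star v (v x) = x := fun x => DFunLike.congr_fun hv x
  have hjv : ∀ x, ContinuousLinearMap.adjoint jc (v x) = 0 := fun x =>
    j.injective (by rw [hjj, hv', sub_self, map_zero])
  have hg : ∀ y x, (g : C(Y, H →L[ℂ] H)) y (v x) = v x := fun y x =>
    DFunLike.congr_fun (DFunLike.congr_fun h₁ y) x
  have hg' : ∀ y x, star v ((g : C(Y, H →L[ℂ] H)) y x) = star v x := fun y x =>
    DFunLike.congr_fun (DFunLike.congr_fun h₂ y) x
  have hgi : ∀ y x, (g : C(Y, H →L[ℂ] H)) y ((g⁻¹ : C(Y, H →L[ℂ] H)ˣ).1 y x) = x := fun y x =>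
    DFunLike.congr_fun (DFunLike.congr_fun g.mul_inv y) x
  have hig : ∀ y x, (g⁻¹ : C(Y, H →L[ℂ] H)ˣ).1 y ((g : C(Y, H →L[ℂ] H)) y x) = x := fun y x =>
    DFunLike.congr_fun (DFunLike.congr_fun g.inv_mul y) x
  have hi : ∀ y x, (g⁻¹ : C(Y, H →L[ℂ] H)ˣ).1 y (v x) = v x := fun y x => by
    conv_lhs => rw [← hg y x, hig]
  have hi' : ∀ y x, star v ((g⁻¹ : C(Y, H →L[ℂ] H)ˣ).1 y x) = star v x := fun y x => by
    rw [← hg', hgi]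
  -- the compression of `g` to `K`
  let cmp : C(Y, H →L[ℂ] H) → C(Y, K →L[ℂ] K) := fun f =>
    ⟨fun y => (ContinuousLinearMap.adjoint jc).comp ((f y).comp jc), by fun_prop⟩
  have hcmp : ∀ (f f' : C(Y, H →L[ℂ] H)), (∀ y x, f y (f' y x) = x) →
      (∀ y x, f y (v x) = v x) → (∀ y x, star v (f' y x) = star v x) → cmp f * cmp f' = 1 :=
    fun f f' hff hf hf' => by
      refine ContinuousMap.ext fun y => ContinuousLinearMap.ext fun x => ?_
      change ContinuousLinearMap.adjoint jc (f y (j (ContinuousLinearMap.adjoint jc (f' y (j x)))))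
        = x
      rw [hjj, map_sub, hf, hff, hf', map_sub, hjv, sub_zero]
      exact hj x
  let x : C(Y, K →L[ℂ] K)ˣ := ⟨cmp g, cmp (g⁻¹ : C(Y, H →L[ℂ] H)ˣ).1, hcmp _ _ hgi hg hi',
    hcmp _ _ hig hi hg'⟩
  let Φ := corner Jc hJ'
  have hΦ : Continuous Φ := continuous_corner Jc hJ'
  have hmem := commutator_mem_nullUnits (Φ.comp D) (Φ.comp D') (hΦ.comp hDc) (hΦ.comp hDc')
    (Φ σ₀) (Φ σ₁) (by rw [← map_mul, hσ₀, map_one]) (by rw [← map_mul, hσ₁, map_one])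
    (fun x => by simp only [MonoidHom.comp_apply, ← map_mul, hcomm]) x
  convert hmem using 1
  refine Units.ext (ContinuousMap.ext fun y => ContinuousLinearMap.ext fun z => ?_)
  change g.1 y z = Φ (D (cmp g.1 y)) z
  have hJ0 : (ContinuousLinearMap.adjoint Jc z) 0 = ContinuousLinearMap.adjoint jc z :=
    ext_inner_left ℂ fun k => by
      refine (lp.inner_single_left (𝕜 := ℂ) (G := fun _ : ℤ => K) 0 k
        (ContinuousLinearMap.adjoint Jc z)).symm.trans ?_
      rw [ContinuousLinearMap.adjoint_inner_right, ContinuousLinearMap.adjoint_inner_right]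
      exact congrArg (inner ℂ · z) (hJ k)
  have hsingle : D (cmp g.1 y) (ContinuousLinearMap.adjoint Jc z) - ContinuousLinearMap.adjoint Jc z
      = lp.single 2 0 (cmp g.1 y (ContinuousLinearMap.adjoint jc z) -
        ContinuousLinearMap.adjoint jc z) := by
    refine lp.ext (funext fun n => ?_)
    rw [lp.coeFn_sub, Pi.sub_apply, hD, lp.single_apply]
    by_cases hn : n = 0
    · subst hn
      rw [if_pos rfl, hJ0, Pi.single_eq_same]
    · rw [if_neg hn, sub_self, Pi.single_eq_of_ne hn]
  have hΦz : Φ (D (cmp g.1 y)) z = z + J (D (cmp g.1 y) (ContinuousLinearMap.adjoint Jc z) -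
    ContinuousLinearMap.adjoint Jc z) := rfl
  rw [hΦz, hsingle, hJ, map_sub]
  change _ = z + (j (ContinuousLinearMap.adjoint jc
    (g.1 y (j (ContinuousLinearMap.adjoint jc z)))) - j (ContinuousLinearMap.adjoint jc z))
  rw [hjj, hg', hjj, map_sub, hg, map_sub, hv', sub_self, map_zero]
  abel

/-- A continuous family of invertible operators that is the identity on the range of an isometry
`v` and splits off on its complement is joined to `1`, as `H` contains the images of that
complement under all powers of `v`. -/
theorem mem_nullUnits_of_fixing {Y : Type*} [TopologicalSpace Y] [CompactSpace Y]
    (v : H →L[ℂ] H) (hv : star v * v = 1) (g : C(Y, H →L[ℂ] H)ˣ)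
    (h₁ : (g : C(Y, H →L[ℂ] H)) * ContinuousMap.const Y v = ContinuousMap.const Y v)
    (h₂ : ContinuousMap.const Y (star v) * (g : C(Y, H →L[ℂ] H)) =
      ContinuousMap.const Y (star v)) :
    g ∈ nullUnits C(Y, H →L[ℂ] H) := by
  obtain ⟨J, hJ⟩ := exists_wold v hv
  let K := (LinearMap.range v.toLinearMap)ᗮ
  have hj := LinearIsometry.adjoint_apply_self K.subtypeₗᵢ
  refine mem_nullUnits_of_wold v hv K.subtypeₗᵢ (fun x => ?_) J hJ g h₁ h₂
  have hv' : ∀ x, star v (v x) = x := fun x => DFunLike.congr_fun hv x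
  have hvK : x - v (star v x) ∈ K := by
    refine (Submodule.mem_orthogonal _ _).2 ?_
    rintro _ ⟨z, rfl⟩
    change inner ℂ (v z) _ = 0
    rw [← ContinuousLinearMap.adjoint_inner_right]
    change inner ℂ z (star v (x - v (star v x))) = 0
    rw [map_sub, hv', sub_self, inner_zero_right]
  have hjv : ∀ x, ContinuousLinearMap.adjoint K.subtypeₗᵢ.toContinuousLinearMap (v x) = 0 :=
    fun x => ext_inner_left ℂ fun z => by
      rw [ContinuousLinearMap.adjoint_inner_right, inner_zero_right]
      exact (Submodule.mem_orthogonal' _ _).1 z.2 _ ⟨x, rfl⟩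
  have h : ContinuousLinearMap.adjoint K.subtypeₗᵢ.toContinuousLinearMap x =
      ⟨x - v (star v x), hvK⟩ := by
    rw [← hj ⟨x - v (star v x), hvK⟩]
    change _ = ContinuousLinearMap.adjoint K.subtypeₗᵢ.toContinuousLinearMap (x - v (star v x))
    rw [map_sub, hjv, sub_zero]
  rw [h]; rfl

end Swindle

/-! ### Kuiper's theorem for compact families -/

section Kuiper

variable {H : Type*} [NormedAddCommGroup H] [InnerProductSpace ℂ H] [CompleteSpace H]

theorem norm_le_one_of_star_mul_self {v : H →L[ℂ] H} (hv : star v * v = 1) : ‖v‖ ≤ 1 := by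
  have h : ‖v‖ * ‖v‖ ≤ 1 := by
    rw [← CStarRing.norm_star_mul_self, hv]; exact ContinuousLinearMap.norm_id_le
  nlinarith [norm_nonneg v]

/-- A continuous family of unitary operators, as a unit of the algebra of continuous families. -/
noncomputable def familyUnit {Y : Type*} [TopologicalSpace Y] (u : C(Y, UnitaryGroup H)) :
    C(Y, H →L[ℂ] H)ˣ where
  val := ⟨fun y => u y, by fun_prop⟩
  inv := ⟨fun y => star (u y : H →L[ℂ] H), by fun_prop⟩
  val_inv := ContinuousMap.ext fun y => Unitary.mul_star_self_of_mem (u y).2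
  inv_val := ContinuousMap.ext fun y => Unitary.star_mul_self_of_mem (u y).2

theorem familyUnit_mem_nullUnits (hH : ¬ FiniteDimensional ℂ H)
    [TopologicalSpace.SeparableSpace H] {Y : Type*} [TopologicalSpace Y] [CompactSpace Y]
    (u : C(Y, UnitaryGroup H)) : familyUnit u ∈ nullUnits C(Y, H →L[ℂ] H) := by
  classical
  have hcomp : IsCompact (range fun y => (u y : H →L[ℂ] H)) := isCompact_range (by fun_prop)
  obtain ⟨t, ht, htc⟩ := Metric.totallyBounded_iff.1 hcomp.totallyBounded (1 / 2) (by norm_num)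
  obtain ⟨v, w, hv, hw, hvw⟩ := exists_isometries hH (insert 1 ht.toFinset)
  have hwv : star w * v = 0 := by simpa using hvw 1 (Finset.mem_insert_self _ _)
  have hvw' : star v * w = 0 := by simpa using congrArg star hwv
  have hv1 := norm_le_one_of_star_mul_self hv
  have hw1 := norm_le_one_of_star_mul_self hw
  let c : (H →L[ℂ] H) → C(Y, H →L[ℂ] H) := ContinuousMap.const Y
  have hcc : ∀ a b d, a * b = d → c a * c b = c d := fun a b d h =>
    ContinuousMap.ext fun _ => h
  obtain ⟨g, h₁, h₂, h₃⟩ := exists_fixing_mod_nullUnits (v := c v) (v' := c (star v)) (w := c w)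
    (w' := c (star w)) (hcc _ _ _ hv) (hcc _ _ _ hw) (hcc _ _ _ hwv) (hcc _ _ _ hvw')
    (familyUnit u) (by
      rw [ContinuousMap.norm_lt_iff _ zero_lt_one]
      intro y
      obtain ⟨g, hg, hgu⟩ := mem_iUnion₂.1 (htc ⟨y, rfl⟩)
      have hgs : star w * g * v = 0 := hvw g (by simp [hg])
      have h1 : star w * (u y : H →L[ℂ] H) * v = star w * ((u y : H →L[ℂ] H) - g) * v := by
        rw [mul_sub, sub_mul, hgs, sub_zero]
      have h2 : ‖(u y : H →L[ℂ] H) - g‖ < 1 / 2 := by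
        rw [← dist_eq_norm]; exact hgu
      have hu1 : ‖(u y : H →L[ℂ] H)‖ ≤ 1 :=
        norm_le_one_of_star_mul_self (Unitary.star_mul_self_of_mem (u y).2)
      change ‖w * (star w * (u y : H →L[ℂ] H) * v) * star v * star (u y : H →L[ℂ] H)‖ < 1
      rw [h1]
      calc _ ≤ ‖w‖ * (‖star w‖ * ‖(u y : H →L[ℂ] H) - g‖ * ‖v‖) * ‖star v‖ *
            ‖star (u y : H →L[ℂ] H)‖ := by
              refine (norm_mul_le _ _).trans (mul_le_mul_of_nonneg_right ?_ (norm_nonneg _))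
              refine (norm_mul_le _ _).trans (mul_le_mul_of_nonneg_right ?_ (norm_nonneg _))
              refine (norm_mul_le _ _).trans (mul_le_mul_of_nonneg_left ?_ (norm_nonneg _))
              refine (norm_mul_le _ _).trans (mul_le_mul_of_nonneg_right ?_ (norm_nonneg _))
              exact norm_mul_le _ _
        _ ≤ 1 * (1 * (1 / 2) * 1) * 1 * 1 := by
              simp only [norm_star]; gcongr
        _ < 1 := by norm_num)
  exact h₃ (mem_nullUnits_of_fixing v hv g h₁ h₂)

/-- **Kuiper's theorem**, weak form: a map from a compact space to the unitary group of an
infinite-dimensional separable Hilbert space, with the norm topology, is null-homotopic. -/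
theorem homotopic_one (hH : ¬ FiniteDimensional ℂ H) [TopologicalSpace.SeparableSpace H]
    {Y : Type*} [TopologicalSpace Y] [CompactSpace Y] (u : C(Y, UnitaryGroup H)) :
    u.Homotopic 1 := by
  obtain ⟨p⟩ := (familyUnit_mem_nullUnits hH u : Joined 1 (familyUnit u))
  have hcont : Continuous fun q : unitInterval × Y => (⟨(p q.1).1 q.2, (p q.1).2 q.2,
      DFunLike.congr_fun (p q.1).mul_inv q.2, DFunLike.congr_fun (p q.1).inv_mul q.2⟩ :
      (H →L[ℂ] H)ˣ) := by
    refine Units.continuous_iff.2 ⟨?_, ?_⟩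
    · change Continuous fun q : unitInterval × Y => (p q.1).1 q.2
      have : Continuous fun q : unitInterval × Y => (p q.1).1 :=
        Units.continuous_val.comp (p.continuous.comp continuous_fst)
      fun_prop
    · change Continuous fun q : unitInterval × Y => ((p q.1)⁻¹).1 q.2
      have : Continuous fun q : unitInterval × Y => ((p q.1)⁻¹).1 :=
        Units.continuous_val.comp (continuous_inv.comp (p.continuous.comp continuous_fst))
      fun_prop
  refine ContinuousMap.Homotopic.symm ⟨⟨⟨_, continuous_unitaryPart.comp hcont⟩, fun y => ?_,
    fun y => ?_⟩⟩
  · refine Eq.trans (congrArg unitaryPart (Units.ext ?_)) (unitaryPart_toUnits 1)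
    change (p 0).1 y = _
    simp
  · refine Eq.trans (congrArg unitaryPart (Units.ext ?_)) (unitaryPart_toUnits (u y))
    change (p 1).1 y = _
    rw [p.target]; rfl

end Kuiper

/-! ### Families of idempotents over a contractible space -/

section Idempotents

variable {B : Type*} [NormedRing B]

/-- The element `p' p + (1 - p') (1 - p)`, which intertwines the idempotents `p` and `p'` and is
invertible when they are close to each other. -/
def transport (p' p : B) : B := p' * p + (1 - p') * (1 - p)

theorem transport_self {p : B} (hp : p * p = p) : transport p p = 1 := by
  simp only [transport, mul_sub, sub_mul, mul_one, one_mul, hp]; abel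

theorem transport_mul {p' p : B} (hp : p * p = p) (hp' : p' * p' = p') :
    transport p' p * p = p' * transport p' p := by
  simp only [transport, mul_sub, sub_mul, add_mul, mul_add, mul_one, one_mul, mul_assoc, hp]
  simp only [← mul_assoc, hp']; abel

/-- If a continuous function `D y t s` vanishes at `s = 0`, then a step size `δ y` such that
`D y t (δ y) < 1` for all `t ∈ [0, 1]` can be chosen continuously. With `M y s` the largest value of
`D y t s'` for `t ∈ [0, 1]` and `0 ≤ s' ≤ s`, the choice is the maximum of
`min s (1 / 2 - M y s)`. -/
theorem exists_continuous_step {Y : Type*} [TopologicalSpace Y] (D : Y → ℝ → ℝ → ℝ)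
    (hD : Continuous fun q : Y × ℝ × ℝ => D q.1 q.2.1 q.2.2) (hD0 : ∀ y t, D y t 0 = 0) :
    ∃ δ : Y → ℝ, Continuous δ ∧ (∀ y, 0 < δ y) ∧ ∀ y, ∀ t ∈ Icc (0 : ℝ) 1, D y t (δ y) < 1 := by
  set Q : Set (ℝ × ℝ) := Icc 0 1 ×ˢ Icc 0 1 with hQ
  have hQc : IsCompact Q := isCompact_Icc.prod isCompact_Icc
  let M : Y → ℝ → ℝ := fun y r => sSup ((fun τ : ℝ × ℝ => D y τ.1 (τ.2 * r)) '' Q)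
  have hM : Continuous fun q : Y × ℝ => M q.1 q.2 := by
    refine hQc.continuous_sSup (f := fun (q : Y × ℝ) (τ : ℝ × ℝ) => D q.1 τ.1 (τ.2 * q.2)) ?_
    exact hD.comp (g := fun q : Y × ℝ × ℝ => D q.1 q.2.1 q.2.2)
      (f := fun a : (Y × ℝ) × ℝ × ℝ => (a.1.1, a.2.1, a.2.2 * a.1.2)) (by fun_prop)
  have hDM : ∀ y r, ∀ t ∈ Icc (0 : ℝ) 1, ∀ s ∈ Icc (0 : ℝ) 1, D y t (s * r) ≤ M y r :=
    fun y r t ht s hs => by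
      refine le_csSup (hQc.image ?_).bddAbove ⟨(t, s), ⟨ht, hs⟩, rfl⟩
      exact hD.comp (g := fun q : Y × ℝ × ℝ => D q.1 q.2.1 q.2.2)
        (f := fun a : ℝ × ℝ => (y, a.1, a.2 * r)) (by fun_prop)
  have hM0 : ∀ y, M y 0 = 0 := fun y => by
    have : (fun τ : ℝ × ℝ => D y τ.1 (τ.2 * 0)) '' Q = {0} := by
      refine Subset.antisymm ?_ ?_
      · rintro _ ⟨τ, -, rfl⟩; simp [hD0]
      · rintro _ rfl; exact ⟨(0, 0), by simp [hQ], by simp [hD0]⟩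
    simp only [M, this, csSup_singleton]
  let k : Y → ℝ → ℝ := fun y s => min s (1 / 2 - M y s)
  have hk : Continuous fun q : Y × ℝ => k q.1 q.2 := by
    change Continuous fun q : Y × ℝ => min q.2 (1 / 2 - M q.1 q.2)
    fun_prop
  have hky : ∀ y, Continuous (k y) := fun y =>
    hk.comp (g := fun q : Y × ℝ => k q.1 q.2) (f := fun s => (y, s)) (by fun_prop)
  let δ : Y → ℝ := fun y => sSup (k y '' Icc 0 1)
  have hpos : ∀ y, 0 < δ y := fun y => by
    have hMy : Continuous (M y) :=
      hM.comp (g := fun q : Y × ℝ => M q.1 q.2) (f := fun s => (y, s)) (by fun_prop)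
    have h1 : ∀ᶠ s in 𝓝 (0 : ℝ), M y s < 1 / 4 :=
      hMy.continuousAt.eventually_lt_const (by rw [hM0]; norm_num)
    obtain ⟨ε, hε, hεM⟩ := Metric.eventually_nhds_iff.1 h1
    set s := min (ε / 2) 1 with hs
    have hs0 : 0 < s := by positivity
    have hsM : M y s < 1 / 4 := hεM (by
      rw [Real.dist_eq, sub_zero, abs_of_pos hs0]
      exact (min_le_left _ _).trans_lt (by linarith))
    have : 0 < k y s := lt_min hs0 (by linarith)
    exact this.trans_le (le_csSup (isCompact_Icc.image (hky y)).bddAbove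
      ⟨s, ⟨hs0.le, min_le_right _ _⟩, rfl⟩)
  refine ⟨δ, isCompact_Icc.continuous_sSup hk, hpos, fun y t ht => ?_⟩
  obtain ⟨s, hs, hsm⟩ :=
    (isCompact_Icc.image (hky y)).sSup_mem ((nonempty_Icc.2 zero_le_one).image _)
  change k y s = δ y at hsm
  have hδs : δ y ≤ s := hsm ▸ min_le_left _ _
  have hδM : δ y ≤ 1 / 2 - M y s := hsm ▸ min_le_right _ _
  have hs0 : 0 < s := (hpos y).trans_le hδs
  have := hDM y s t ht (δ y / s) ⟨by have := hpos y; positivity, (div_le_one hs0).2 hδs⟩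
  rw [div_mul_cancel₀ _ hs0.ne'] at this
  linarith [hpos y]

/-- **Homotopy invariance.** A continuous family of idempotents over a contractible space is
conjugate to a constant one. The family is transported along the contraction by finitely many
steps, of a length that depends continuously on the point; the number of steps does not matter,
because once the end of the contraction is reached the transport is trivial. -/
theorem exists_intertwiner [CompleteSpace B] {Y : Type*} [TopologicalSpace Y] [ContractibleSpace Y]
    (p : Y → B) (hp : Continuous p) (hpp : ∀ y, p y * p y = p y) :
    ∃ (y₀ : Y) (Z : Y → Bˣ), Continuous Z ∧ ∀ y, (Z y : B) * p y = p y₀ * Z y := by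
  obtain ⟨y₀, ⟨c⟩⟩ := id_nullhomotopic Y
  let q : Y → ℝ → B := fun y t => p (c (projIcc 0 1 zero_le_one t, y))
  have hq : Continuous fun a : Y × ℝ => q a.1 a.2 := by
    have := continuous_projIcc (a := (0 : ℝ)) (b := 1) (h := zero_le_one)
    change Continuous fun a : Y × ℝ => p (c (projIcc 0 1 zero_le_one a.2, a.1))
    fun_prop
  have hqq : ∀ y t, q y t * q y t = q y t := fun y t => hpp _
  have hq0 : ∀ y, q y 0 = p y := fun y => by simp [q]
  have hq1 : ∀ y t, 1 ≤ t → q y t = p y₀ := fun y t ht => by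
    simp only [q, projIcc_of_right_le _ ht]
    exact congrArg p (c.apply_one y)
  let D : Y → ℝ → ℝ → ℝ := fun y t s => ‖transport (q y (t + s)) (q y t) - 1‖
  obtain ⟨δ, hδ, hδ0, hδD⟩ := exists_continuous_step D (by
    have h1 : Continuous fun a : Y × ℝ × ℝ => q a.1 (a.2.1 + a.2.2) :=
      hq.comp (g := fun a : Y × ℝ => q a.1 a.2) (f := fun a : Y × ℝ × ℝ => (a.1, a.2.1 + a.2.2))
        (by fun_prop)
    have h2 : Continuous fun a : Y × ℝ × ℝ => q a.1 a.2.1 :=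
      hq.comp (g := fun a : Y × ℝ => q a.1 a.2) (f := fun a : Y × ℝ × ℝ => (a.1, a.2.1))
        (by fun_prop)
    change Continuous fun a : Y × ℝ × ℝ =>
      ‖q a.1 (a.2.1 + a.2.2) * q a.1 a.2.1 + (1 - q a.1 (a.2.1 + a.2.2)) * (1 - q a.1 a.2.1) - 1‖
    fun_prop) (fun y t => by simp [D, transport_self (hqq y t)])
  let step : ℕ → Y → B := fun n y => transport (q y ((n + 1 : ℕ) * δ y)) (q y (n * δ y))
  have hqn : ∀ n : ℕ, Continuous fun y => q y (n * δ y) := fun n =>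
    hq.comp (g := fun a : Y × ℝ => q a.1 a.2) (f := fun y => (y, n * δ y)) (by fun_prop)
  have hstepc : ∀ n, Continuous (step n) := fun n => by
    have h1 := hqn n
    have h2 := hqn (n + 1)
    change Continuous fun y => q y ((n + 1 : ℕ) * δ y) * q y (n * δ y) +
      (1 - q y ((n + 1 : ℕ) * δ y)) * (1 - q y (n * δ y))
    fun_prop
  have hstep1 : ∀ (n : ℕ) y, 1 ≤ n * δ y → step n y = 1 := fun n y h => by
    have h' : 1 ≤ (n + 1 : ℕ) * δ y := by push_cast; nlinarith [hδ0 y]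
    simp only [step, hq1 y _ h, hq1 y _ h', transport_self (hpp y₀)]
  have hstepu : ∀ (n : ℕ) y, IsUnit (step n y) := fun n y => by
    rcases le_total 1 (n * δ y) with h | h
    · rw [hstep1 n y h]; exact isUnit_one
    · have h' := hδD y (n * δ y) ⟨by have := hδ0 y; positivity, h⟩
      have h2 : n * δ y + δ y = (n + 1 : ℕ) * δ y := by push_cast; ring
      simp only [D, h2] at h'
      have := (Units.oneSub (1 - step n y) (by rw [norm_sub_rev]; exact h')).isUnit
      simpa using this
  let Z : ℕ → Y → B := fun n => Nat.rec (fun _ => 1) (fun n Zn y => step n y * Zn y) n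
  have hZs : ∀ n y, Z (n + 1) y = step n y * Z n y := fun n y => rfl
  have hZc : ∀ n, Continuous (Z n) := fun n => by
    induction n with
    | zero => exact continuous_const
    | succ n ih => exact (hstepc n).mul ih
  have hZu : ∀ n y, IsUnit (Z n y) := fun n y => by
    induction n with
    | zero => exact isUnit_one
    | succ n ih => exact (hstepu n y).mul ih
  have hZp : ∀ n y, Z n y * p y = q y (n * δ y) * Z n y := fun n y => by
    induction n with
    | zero => simp [Z, hq0]
    | succ n ih =>
      rw [hZs, mul_assoc, ih, ← mul_assoc, transport_mul (hqq _ _) (hqq _ _), mul_assoc]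
  have hZst : ∀ (n : ℕ) y, 1 ≤ n * δ y → ∀ m, n ≤ m → Z m y = Z n y := fun n y h m hm => by
    induction m, hm using Nat.le_induction with
    | base => rfl
    | succ m hm ih =>
      have h1 : 1 ≤ m * δ y := h.trans (by
        have := hδ0 y
        gcongr)
      rw [hZs, hstep1 m y h1, one_mul, ih]
  choose N hN using fun y => exists_nat_gt (1 / δ y)
  have hN' : ∀ y, 1 < N y * δ y := fun y => by
    have := hN y; rwa [div_lt_iff₀ (hδ0 y)] at this
  have hcont : Continuous fun y => Z (N y) y := by
    refine continuous_iff_continuousAt.2 fun y₁ => ?_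
    refine (hZc (N y₁)).continuousAt.congr ?_
    have hev : ∀ᶠ y in 𝓝 y₁, 1 < N y₁ * δ y :=
      (continuous_const.mul hδ).continuousAt.eventually_const_lt (hN' y₁)
    filter_upwards [hev] with y hy
    rcases le_total (N y) (N y₁) with h | h
    · exact hZst _ _ (hN' y).le _ h
    · exact (hZst _ _ hy.le _ h).symm
  obtain ⟨d, hd, hd'⟩ := exists_continuous_units _ hcont fun y => hZu _ y
  refine ⟨y₀, d, hd, fun y => ?_⟩
  rw [hd', hZp, hq1 y _ (hN' y).le]

end Idempotents

/-! ### Hilbert bundles over a contractible set -/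

section Trivialization

variable {X : Type*} [TopologicalSpace X] {H : Type*} [NormedAddCommGroup H]
  [InnerProductSpace ℂ H] [CompleteSpace H] {S : Type*} {V : S → Set X} {D : Set X}
  {h : S → S → X → UnitaryGroup H} {L : Type*} [NormedAddCommGroup L] [InnerProductSpace ℂ L]

local notation:max T "†" => ContinuousLinearMap.adjoint T

/-- The isometric embedding, in the chart `r`, of the fibre over `x` of the Hilbert bundle with
transition functions `h` into a Hilbert space `L` that contains one copy `j s` of the fibre for each
chart `s`. -/
noncomputable def bundleEmbedding (φ : PartitionOfUnity S X) (j : S → H →L[ℂ] L)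
    (h : S → S → X → UnitaryGroup H) (r : S) (x : X) : H →L[ℂ] L :=
  ∑ᶠ s, √(φ s x) • (j s).comp (h s r x : H →L[ℂ] H)

theorem bundleEmbedding_eq_sum (φ : PartitionOfUnity S X) (j : S → H →L[ℂ] L) (r : S) (x : X)
    (F : Finset S) (hF : φ.finsupport x ⊆ F) :
    bundleEmbedding φ j h r x = ∑ s ∈ F, √(φ s x) • (j s).comp (h s r x : H →L[ℂ] H) := by
  refine finsum_eq_sum_of_support_subset _ fun s hs => ?_
  refine hF ((φ.mem_finsupport x).2 fun h0 => hs ?_)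
  simp [h0]

theorem bundleEmbedding_comp {φ : PartitionOfUnity S X} (hφ : φ.IsSubordinate V)
    (j : S → H →L[ℂ] L)
    (hcoc : ∀ t s r, ∀ x ∈ V r ∩ V s ∩ V t ∩ D, h t s x * h s r x = h t r x) {s r : S} {x : X}
    (hx : x ∈ V r ∩ V s ∩ D) (v : H) :
    bundleEmbedding φ j h r x v = bundleEmbedding φ j h s x ((h s r x : H →L[ℂ] H) v) := by
  rw [bundleEmbedding_eq_sum φ j r x _ subset_rfl, bundleEmbedding_eq_sum φ j s x _ subset_rfl]
  simp only [sum_apply, smul_apply, ContinuousLinearMap.comp_apply]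
  refine Finset.sum_congr rfl fun t ht => ?_
  have hxt : x ∈ V t := hφ t (subset_closure ((φ.mem_finsupport x).1 ht))
  rw [← hcoc t s r x ⟨⟨hx.1, hxt⟩, hx.2⟩]
  rfl

theorem continuousOn_bundleEmbedding (hV : ∀ s, IsOpen (V s)) {φ : PartitionOfUnity S X}
    (hφ : φ.IsSubordinate V) (j : S → H →L[ℂ] L)
    (hc : ∀ s r, ContinuousOn (h s r) (V r ∩ V s ∩ D)) (r : S) :
    ContinuousOn (bundleEmbedding φ j h r) (V r ∩ D) := by
  intro x hx
  have h1 : ContinuousWithinAt (fun y => ∑ s ∈ φ.fintsupport x,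
      √(φ s y) • (j s).comp (h s r y : H →L[ℂ] H)) (V r ∩ D) x := by
    refine tendsto_finsetSum _ fun s hs => ?_
    have hxs : x ∈ V s := hφ s ((φ.mem_fintsupport_iff x s).1 hs)
    have h2 : ContinuousWithinAt (h s r) (V r ∩ D) x := by
      refine ((hc s r) x ⟨⟨hx.1, hxs⟩, hx.2⟩).mono_of_mem_nhdsWithin ?_
      filter_upwards [self_mem_nhdsWithin, mem_nhdsWithin_of_mem_nhds ((hV s).mem_nhds hxs)]
        with y hy hys using ⟨⟨hy.1, hys⟩, hy.2⟩
    have h3 : ContinuousWithinAt (fun y => √(φ s y)) (V r ∩ D) x :=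
      (Real.continuous_sqrt.comp (φ s).continuous).continuousWithinAt
    exact h3.smul (continuousWithinAt_const.clm_comp
      (continuous_subtype_val.continuousAt.comp_continuousWithinAt h2))
  refine h1.congr_of_eventuallyEq ?_
    (bundleEmbedding_eq_sum φ j r x _ (φ.finsupport_subset_fintsupport x))
  filter_upwards [mem_nhdsWithin_of_mem_nhds (φ.eventually_finsupport_subset x)] with y hy
  exact bundleEmbedding_eq_sum φ j r y _ hy

variable [CompleteSpace L]

theorem adjoint_bundleEmbedding (φ : PartitionOfUnity S X) {j : S → H →L[ℂ] L}
    (hj : ∀ s v, (j s)† (j s v) = v) (hj' : ∀ s t v, s ≠ t → (j s)† (j t v) = 0) (r : S) (x : X)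
    (v : H) : (bundleEmbedding φ j h r x)† (bundleEmbedding φ j h r x v) = v := by
  classical
  refine ext_inner_left ℂ fun z => ?_
  rw [ContinuousLinearMap.adjoint_inner_right, bundleEmbedding_eq_sum φ j r x _ subset_rfl]
  simp only [sum_apply, smul_apply,
    ContinuousLinearMap.comp_apply, sum_inner, inner_sum]
  have hterm : ∀ s t, inner ℂ (√(φ s x) • j s ((h s r x : H →L[ℂ] H) z))
      (√(φ t x) • j t ((h t r x : H →L[ℂ] H) v)) =
      if s = t then (φ s x : ℂ) * inner ℂ z v else 0 := fun s t => by
    rw [inner_smul_left_eq_smul, inner_smul_right_eq_smul,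
      ← ContinuousLinearMap.adjoint_inner_right]
    split_ifs with hst
    · subst hst
      rw [hj, ← ContinuousLinearMap.adjoint_inner_right]
      have hu : (h s r x : H →L[ℂ] H)† ((h s r x : H →L[ℂ] H) v) = v :=
        DFunLike.congr_fun (Unitary.star_mul_self_of_mem (h s r x).2) v
      rw [hu, smul_smul, Real.mul_self_sqrt (φ.nonneg s x), Complex.real_smul]
    · rw [hj' s t _ hst, inner_zero_right, smul_zero, smul_zero]
  simp only [hterm, Finset.sum_ite_eq']
  have h1 := φ.sum_finsupport (mem_univ x)
  rw [Finset.sum_congr rfl (fun s hs => if_pos hs), ← Finset.sum_mul, ← Complex.ofReal_sum, h1]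
  simp

theorem exists_trivialization_of_embedding [T2Space X] [ParacompactSpace X]
    (hV : IsOpenCovering V) [ContractibleSpace D]
    (hc : ∀ s r, ContinuousOn (h s r) (V r ∩ V s ∩ D))
    (hcoc : ∀ t s r, ∀ x ∈ V r ∩ V s ∩ V t ∩ D, h t s x * h s r x = h t r x)
    {j : S → H →L[ℂ] L}
    (hj : ∀ s v, (j s)† (j s v) = v) (hj' : ∀ s t v, s ≠ t → (j s)† (j t v) = 0) :
    ∃ w : S → X → UnitaryGroup H, (∀ s, ContinuousOn (w s) (V s ∩ D)) ∧
      ∀ s r, ∀ x ∈ V r ∩ V s ∩ D, h s r x * w r x = w s x := by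
  classical
  obtain ⟨φ, hφ⟩ := PartitionOfUnity.exists_isSubordinate isClosed_univ V hV.isOpen
    (fun x _ => mem_iUnion.2 (hV.covers x))
  let J := bundleEmbedding φ j h
  have hJJ : ∀ r x v, (J r x)† (J r x v) = v := adjoint_bundleEmbedding φ hj hj'
  have hJc : ∀ r, ContinuousOn (J r) (V r ∩ D) := continuousOn_bundleEmbedding hV.isOpen hφ j hc
  have hJh : ∀ s r x, x ∈ V r ∩ V s ∩ D → ∀ v, J r x v = J s x ((h s r x : H →L[ℂ] H) v) :=
    fun s r x hx v => bundleEmbedding_comp hφ j hcoc hx v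
  choose ρ hρ using hV.covers
  -- the projection onto the image of the fibre, which does not depend on the chart
  let p : X → L →L[ℂ] L := fun x => (J (ρ x) x).comp (J (ρ x) x)†
  have hp : ∀ r x, x ∈ V r ∩ D → p x = (J r x).comp (J r x)† := fun r x hx => by
    have h1 : J (ρ x) x = (J r x).comp (h r (ρ x) x : H →L[ℂ] H) :=
      ContinuousLinearMap.ext fun v => hJh r (ρ x) x ⟨⟨hρ x, hx.1⟩, hx.2⟩ v
    have h2 : (h r (ρ x) x : H →L[ℂ] H).comp (h r (ρ x) x : H →L[ℂ] H)† = 1 :=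
      Unitary.mul_star_self_of_mem (h r (ρ x) x).2
    simp only [p]
    rw [h1, ContinuousLinearMap.adjoint_comp, ContinuousLinearMap.comp_assoc,
      ← ContinuousLinearMap.comp_assoc (h r (ρ x) x : H →L[ℂ] H), h2]
    rfl
  have hpv : ∀ r x, x ∈ V r ∩ D → ∀ v, p x v = J r x ((J r x)† v) := fun r x hx v => by
    rw [hp r x hx]; rfl
  have hpp : ∀ x, p x * p x = p x := fun x => ContinuousLinearMap.ext fun v => by
    change J (ρ x) x ((J (ρ x) x)† (J (ρ x) x ((J (ρ x) x)† v))) = J (ρ x) x ((J (ρ x) x)† v)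
    rw [hJJ]
  have hpc : ContinuousOn p D := fun x hx => by
    have h1 := hJc (ρ x) x ⟨hρ x, hx⟩
    have h2 : ContinuousWithinAt (fun y => (J (ρ x) y).comp (J (ρ x) y)†) (V (ρ x) ∩ D) x :=
      h1.clm_comp (ContinuousLinearMap.adjoint.continuous.continuousAt.comp_continuousWithinAt h1)
    have h3 : V (ρ x) ∩ D ∈ 𝓝[D] x :=
      inter_mem (mem_nhdsWithin_of_mem_nhds ((hV.isOpen _).mem_nhds (hρ x))) self_mem_nhdsWithin
    refine (h2.mono_of_mem_nhdsWithin h3).congr_of_eventuallyEq ?_ (hp (ρ x) x ⟨hρ x, hx⟩)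
    filter_upwards [h3] with y hy using hp _ y hy
  obtain ⟨y₀, Z, hZ, hZp⟩ := exists_intertwiner (fun x : D => p x)
    (continuousOn_iff_continuous_domRestrict.1 hpc) (fun x => hpp x)
  have hZpv : ∀ (x : D) v, (Z x : L →L[ℂ] L) (p x v) = p y₀ ((Z x : L →L[ℂ] L) v) := fun x v =>
    DFunLike.congr_fun (hZp x) v
  have hZi : ∀ (x : D) v, (Z x : L →L[ℂ] L) (((Z x)⁻¹ : (L →L[ℂ] L)ˣ).1 v) = v := fun x v =>
    DFunLike.congr_fun (Z x).mul_inv v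
  have hiZ : ∀ (x : D) v, ((Z x)⁻¹ : (L →L[ℂ] L)ˣ).1 ((Z x : L →L[ℂ] L) v) = v := fun x v =>
    DFunLike.congr_fun (Z x).inv_mul v
  let J₀ := J (ρ y₀) y₀
  have hp0 : ∀ v, p y₀ v = J₀ (J₀† v) := fun v => rfl
  -- the bundle map to the fibre over `y₀`, in the chart `r`
  let k : ∀ r, ↥(V r ∩ D) → (H →L[ℂ] H)ˣ := fun r x =>
    { val := J₀†.comp ((Z ⟨x, x.2.2⟩ : L →L[ℂ] L).comp (J r x))
      inv := (J r x)†.comp (((Z ⟨x, x.2.2⟩)⁻¹ : (L →L[ℂ] L)ˣ).1.comp J₀)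
      val_inv := ContinuousLinearMap.ext fun v => by
        change J₀† ((Z ⟨x, x.2.2⟩ : L →L[ℂ] L) (J r x ((J r x)†
          (((Z ⟨x, x.2.2⟩)⁻¹ : (L →L[ℂ] L)ˣ).1 (J₀ v))))) = v
        rw [← hpv r x x.2, hZpv ⟨x, x.2.2⟩, hZi, hp0, hJJ, hJJ]
      inv_val := ContinuousLinearMap.ext fun v => by
        change (J r x)† (((Z ⟨x, x.2.2⟩)⁻¹ : (L →L[ℂ] L)ˣ).1 (J₀ (J₀†
          ((Z ⟨x, x.2.2⟩ : L →L[ℂ] L) (J r x v))))) = v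
        rw [← hp0, ← hZpv ⟨x, x.2.2⟩, hiZ, hpv r x x.2, hJJ, hJJ] }
  have hk : ∀ r, Continuous (k r) := fun r => by
    have h1 : Continuous fun x : ↥(V r ∩ D) => J r x :=
      continuousOn_iff_continuous_domRestrict.1 (hJc r)
    have h2 : Continuous fun x : ↥(V r ∩ D) => Z ⟨x, x.2.2⟩ := hZ.comp (by fun_prop)
    refine Units.continuous_iff.2 ⟨?_, ?_⟩
    · exact continuous_const.clm_comp ((Units.continuous_val.comp h2).clm_comp h1)
    · exact (ContinuousLinearMap.adjoint.continuous.comp h1).clm_comp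
        ((Units.continuous_val.comp (continuous_inv.comp h2)).clm_comp continuous_const)
  refine ⟨fun r x => if hx : x ∈ V r ∩ D then (unitaryPart (k r ⟨x, hx⟩))⁻¹ else 1,
    fun r => ?_, fun s r x hx => ?_⟩
  · rw [continuousOn_iff_continuous_domRestrict]
    refine (continuous_inv.comp (continuous_unitaryPart.comp (hk r))).congr fun x => ?_
    simp only [domRestrict_apply, dif_pos x.2]
    rfl
  · have hr : x ∈ V r ∩ D := ⟨hx.1.1, hx.2⟩
    have hs : x ∈ V s ∩ D := ⟨hx.1.2, hx.2⟩
    have hks : k r ⟨x, hr⟩ = k s ⟨x, hs⟩ * Unitary.toUnits (h s r x) :=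
      Units.ext (ContinuousLinearMap.ext fun v => by
        change J₀† ((Z ⟨x, hx.2⟩ : L →L[ℂ] L) (J r x v)) =
          J₀† ((Z ⟨x, hx.2⟩ : L →L[ℂ] L) (J s x ((h s r x : H →L[ℂ] H) v)))
        rw [hJh s r x hx])
    simp only [dif_pos hr, dif_pos hs, hks, unitaryPart_mul]
    group

/-- A Hilbert bundle, given by a unitary cocycle `h` on an open covering of a paracompact space, is
trivial over every contractible subset. -/
theorem exists_trivialization [T2Space X] [ParacompactSpace X]
    (hV : IsOpenCovering V) [ContractibleSpace D]
    (hc : ∀ s r, ContinuousOn (h s r) (V r ∩ V s ∩ D))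
    (hcoc : ∀ t s r, ∀ x ∈ V r ∩ V s ∩ V t ∩ D, h t s x * h s r x = h t r x) :
    ∃ w : S → X → UnitaryGroup H, (∀ s, ContinuousOn (w s) (V s ∩ D)) ∧
      ∀ s r, ∀ x ∈ V r ∩ V s ∩ D, h s r x * w r x = w s x := by
  classical
  let j : S → H →L[ℂ] lp (fun _ : S => H) 2 := fun s =>
    lp.singleContinuousLinearMap ℂ (fun _ : S => H) 2 s
  have hj : ∀ s t v, (j s)† (j t v) = if s = t then v else 0 := fun s t v =>
    ext_inner_left ℂ fun z => by
      rw [ContinuousLinearMap.adjoint_inner_right]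
      refine (lp.inner_single_left (𝕜 := ℂ) (G := fun _ : S => H) s z (j t v)).trans ?_
      congr 1
      refine (lp.single_apply (E := fun _ : S => H) 2 t v s).trans ?_
      split_ifs with hst
      · subst hst; exact Pi.single_eq_same _ _
      · exact Pi.single_eq_of_ne hst _
  exact exists_trivialization_of_embedding hV hc hcoc (j := j)
    (fun s v => by rw [hj, if_pos rfl]) (fun s t v hst => by rw [hj, if_neg hst])

end Trivialization

/-! ### Maps to `PU(H)` and isomorphisms of algebra bundles -/

section Bundles

variable {X : Type u} [TopologicalSpace X] {H : Type w} [NormedAddCommGroup H]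
  [InnerProductSpace ℂ H] [CompleteSpace H]

theorem continuous_scalar : Continuous (scalar H) :=
  Continuous.subtype_mk ((continuous_subtype_val : Continuous ((↑) : Circle → ℂ)).smul
    continuous_const) _

theorem conj_scalar (z : Circle) : conj H (scalar H z) = 1 :=
  (congrArg (PU.ad H) ((QuotientGroup.eq_one_iff _).2 ⟨_, rfl⟩)).trans (map_one _)

/-- The action of `PU(H)` on `𝓛(H)` is faithful, as the centre of `𝓛(H)` consists of scalars. -/
theorem PU.ad_injective [Nontrivial H] : Function.Injective (PU.ad H) := by
  refine (injective_iff_map_eq_one _).2 fun q => ?_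
  induction q using QuotientGroup.induction_on with
  | H g =>
    intro hg
    have h1 : Unitary.conjStarAlgAut ℂ (H →L[ℂ] H) g = Unitary.conjStarAlgAut ℂ (H →L[ℂ] H) 1 :=
      Eq.trans (b := (1 : AlgAut H)) hg (map_one _).symm
    obtain ⟨α, hα⟩ := (Unitary.conjStarAlgAut_ext_iff _ _).1 h1
    have h2 : ‖α‖ = 1 := by
      have := congrArg norm hα
      rw [CStarRing.norm_coe_unitary, norm_smul, CStarRing.norm_coe_unitary, mul_one] at this
      exact this.symm
    refine (QuotientGroup.eq_one_iff _).2 ⟨⟨α, mem_sphere_zero_iff_norm.2 h2⟩, ?_⟩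
    ext1
    exact hα.symm

theorem ContinuousInPU.mono {s t : Set X} {α : X → AlgAut H} (h : ContinuousInPU t α)
    (hst : s ⊆ t) : ContinuousInPU s α := by
  obtain ⟨γ, hγ, hα⟩ := h
  exact ⟨γ, hγ.mono hst, fun x hx => hα x (hst hx)⟩

theorem ContinuousInPU.congr {s : Set X} {α β : X → AlgAut H} (h : ContinuousInPU s α)
    (hβ : ∀ x ∈ s, β x = α x) : ContinuousInPU s β := by
  obtain ⟨γ, hγ, hα⟩ := h
  exact ⟨γ, hγ, fun x hx => (hβ x hx).trans (hα x hx)⟩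

theorem ContinuousInPU.mul {s : Set X} {α β : X → AlgAut H} (hα : ContinuousInPU s α)
    (hβ : ContinuousInPU s β) : ContinuousInPU s fun x => α x * β x := by
  obtain ⟨γ, hγ, hγα⟩ := hα
  obtain ⟨δ, hδ, hδβ⟩ := hβ
  exact ⟨fun x => γ x * δ x, hγ.mul hδ, fun x hx => by
    simp only [map_mul, hγα x hx, hδβ x hx]⟩

theorem ContinuousInPU.inv {s : Set X} {α : X → AlgAut H} (hα : ContinuousInPU s α) :
    ContinuousInPU s fun x => (α x)⁻¹ := by
  obtain ⟨γ, hγ, hγα⟩ := hα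
  exact ⟨fun x => (γ x)⁻¹, hγ.inv, fun x hx => by
    simp only [map_inv, hγα x hx]⟩

theorem continuousInPU_conj {s : Set X} {g : X → UnitaryGroup H} (hg : ContinuousOn g s) :
    ContinuousInPU s fun x => conj H (g x) :=
  ⟨fun x => (g x : PU H), continuous_quotient_mk'.comp_continuousOn hg, fun _ _ => rfl⟩

/-- Since `PU(H)` acts faithfully, continuity as a map to `PU(H)` can be checked locally. -/
theorem continuousInPU_of_local [Nontrivial H] {s : Set X} {α : X → AlgAut H}
    (h : ∀ x ∈ s, ∃ t, IsOpen t ∧ x ∈ t ∧ ContinuousInPU (t ∩ s) α) : ContinuousInPU s α := by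
  classical
  have hex : ∀ x ∈ s, ∃ γ : PU H, α x = PU.ad H γ := fun x hx => by
    obtain ⟨t, -, hxt, γ, -, hγ⟩ := h x hx
    exact ⟨γ x, hγ x ⟨hxt, hx⟩⟩
  choose! γ hγ using hex
  refine ⟨γ, fun x hx => ?_, hγ⟩
  obtain ⟨t, hto, hxt, δ, hδ, hδα⟩ := h x hx
  have heq : ∀ z ∈ t ∩ s, γ z = δ z := fun z hz =>
    PU.ad_injective ((hγ z hz.2).symm.trans (hδα z hz))
  have hmem : t ∩ s ∈ 𝓝[s] x :=
    inter_mem (mem_nhdsWithin_of_mem_nhds (hto.mem_nhds hxt)) self_mem_nhdsWithin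
  refine ((hδ x ⟨hxt, hx⟩).mono_of_mem_nhdsWithin hmem).congr_of_eventuallyEq ?_ (heq x ⟨hxt, hx⟩)
  filter_upwards [hmem] with z hz using heq z hz

theorem AlgebraBundle.trans_self (A : AlgebraBundle.{u, v, w} X H) {a : A.Index} {x : X}
    (hx : x ∈ A.base a) : A.trans a a x = 1 :=
  mul_eq_left.1 (A.cocycle a a a x ⟨⟨hx, hx⟩, hx⟩)

theorem AlgebraBundle.Isomorphic.symm {A : AlgebraBundle.{u, v, w} X H}
    {B : AlgebraBundle.{u, y, w} X H} (h : A.Isomorphic B) : B.Isomorphic A := by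
  obtain ⟨θ, hθ, hθ'⟩ := h
  refine ⟨fun a b x => (θ b a x)⁻¹, fun a b => (hθ b a).inv.mono (by rw [inter_comm]),
    fun a' a b' b x hx => ?_⟩
  rw [inv_mul_eq_iff_eq_mul, ← mul_assoc, eq_mul_inv_iff_mul_eq]
  exact (hθ' b' b a' a x ⟨hx.2, hx.1⟩).symm

universe v₁ v₂ v₃ in
theorem AlgebraBundle.Isomorphic.trans [Nontrivial H] {A : AlgebraBundle.{u, v₁, w} X H}
    {B : AlgebraBundle.{u, v₂, w} X H} {C : AlgebraBundle.{u, v₃, w} X H} (h : A.Isomorphic B)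
    (h' : B.Isomorphic C) : A.Isomorphic C := by
  obtain ⟨θ, hθ, hθ'⟩ := h
  obtain ⟨η, hη, hη'⟩ := h'
  choose ρ hρ using B.covering.covers
  have hind : ∀ c b b' a x, x ∈ A.base a ∩ (B.base b ∩ B.base b') ∩ C.base c →
      η c b' x * θ b' a x = η c b x * θ b a x := fun c b b' a x hx => by
    have h1 := hθ' b' b a a x ⟨⟨hx.1.1, hx.1.1⟩, hx.1.2⟩
    have h2 := hη' c c b' b x ⟨hx.1.2, ⟨hx.2, hx.2⟩⟩
    rw [A.trans_self hx.1.1, mul_one] at h1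
    rw [C.trans_self hx.2, one_mul] at h2
    rw [h1, ← mul_assoc, h2]
  refine ⟨fun c a x => η c (ρ x) x * θ (ρ x) a x, fun c a => ?_, fun c' c a' a x hx => ?_⟩
  · refine continuousInPU_of_local fun x hx =>
      ⟨B.base (ρ x), B.covering.isOpen _, hρ x, ?_⟩
    refine ContinuousInPU.congr (((hη c (ρ x)).mono ?_).mul ((hθ (ρ x) a).mono ?_)) fun z hz =>
      hind _ _ _ _ _ ⟨⟨hz.2.1, hz.1, hρ z⟩, hz.2.2⟩
    · exact fun z hz => ⟨hz.1, hz.2.2⟩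
    · exact fun z hz => ⟨hz.2.1, hz.1⟩
  · have h1 := hθ' (ρ x) (ρ x) a' a x ⟨hx.1, hρ x, hρ x⟩
    have h2 := hη' c' c (ρ x) (ρ x) x ⟨⟨hρ x, hρ x⟩, hx.2⟩
    rw [B.trans_self (hρ x), one_mul] at h1
    rw [B.trans_self (hρ x), mul_one] at h2
    rw [mul_assoc, h1, h2, mul_assoc]

end Bundles

/-! ### From associated algebra bundles to twisted Hilbert bundles -/

section Twisted

variable {X : Type u} [TopologicalSpace X] {H : Type w} [NormedAddCommGroup H]
  [InnerProductSpace ℂ H] [CompleteSpace H] {ι : Type v} {U : ι → Set X}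

theorem IsGoodCovering.contractible_single (hU : IsGoodCovering U) {i : ι} (h : (U i).Nonempty) :
    ContractibleSpace (U i) := by
  have h1 : (⋂ j ∈ ({i} : Finset ι), U j) = U i := by simp
  have := hU.contractible {i} (Finset.singleton_nonempty i) (by rwa [h1])
  rwa [h1] at this

/-- Let `g` be a `lam`-twisted cocycle on a refinement `V` of the covering `U`. Over a fixed `U i`,
division by `lam i s r` turns it into an honest cocycle, which is trivial as `U i` is
contractible. -/
theorem exists_untwisting [T2Space X] [ParacompactSpace X] (hU : IsGoodCovering U)
    (lam : NormalizedCocycle U) {S : Type*} {V : S → Set X} (hV : IsOpenCovering V) {τ : S → ι}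
    (hτ : ∀ s, V s ⊆ U (τ s)) {g : S → S → X → UnitaryGroup H}
    (hg : ∀ s r, ContinuousOn (g s r) (V r ∩ V s))
    (hgg : ∀ t s r, ∀ x ∈ V r ∩ V s ∩ V t,
      g t s x * g s r x = g t r x * scalar H (lam.toFun (τ t) (τ s) (τ r) x)) :
    ∃ w : ι → S → X → UnitaryGroup H, (∀ i s, ContinuousOn (w i s) (V s ∩ U i)) ∧
      ∀ i s r, ∀ x ∈ V r ∩ V s ∩ U i,
        g s r x * w i r x = w i s x * scalar H (lam.toFun i (τ s) (τ r) x) := by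
  have key : ∀ i, ∃ w : S → X → UnitaryGroup H, (∀ s, ContinuousOn (w s) (V s ∩ U i)) ∧
      ∀ s r, ∀ x ∈ V r ∩ V s ∩ U i,
        g s r x * w r x = w s x * scalar H (lam.toFun i (τ s) (τ r) x) := fun i => by
    rcases (U i).eq_empty_or_nonempty with h0 | h0
    · exact ⟨fun _ _ => 1, fun _ => continuousOn_const, fun s r x hx => by simp [h0] at hx⟩
    have := hU.contractible_single h0
    obtain ⟨w, hw, hww⟩ := exists_trivialization hV (D := U i)
      (h := fun s r x => g s r x * scalar H (lam.toFun i (τ s) (τ r) x)⁻¹)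
      (fun s r => by
        refine ((hg s r).mono inter_subset_left).mul
          (continuous_scalar.comp_continuousOn
            (ContinuousOn.inv ((lam.continuousOn _ _ _).mono ?_)))
        exact fun x hx => ⟨⟨hτ r hx.1.1, hτ s hx.1.2⟩, hx.2⟩)
      (fun t s r x hx => by
        have hl := lam.cocycle i (τ t) (τ s) (τ r) x
          ⟨⟨⟨hτ r hx.1.1.1, hτ s hx.1.1.2⟩, hτ t hx.1.2⟩, hx.2⟩
        calc g t s x * scalar H (lam.toFun i (τ t) (τ s) x)⁻¹ *
              (g s r x * scalar H (lam.toFun i (τ s) (τ r) x)⁻¹)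
            = g t s x * g s r x * (scalar H (lam.toFun i (τ t) (τ s) x)⁻¹ *
                scalar H (lam.toFun i (τ s) (τ r) x)⁻¹) := by
              rw [mul_assoc, ← mul_assoc (scalar H _) (g s r x), ← scalar_mul_comm]
              simp only [mul_assoc]
          _ = g t r x * scalar H (lam.toFun (τ t) (τ s) (τ r) x *
                (lam.toFun i (τ t) (τ s) x * lam.toFun i (τ s) (τ r) x)⁻¹) := by
              rw [hgg t s r x hx.1, mul_assoc]
              simp only [← map_mul, mul_inv]
          _ = _ := by rw [hl, mul_inv, mul_inv_cancel_left])
    refine ⟨w, hw, fun s r x hx => ?_⟩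
    rw [← hww s r x hx, mul_assoc, mul_assoc, scalar_mul_comm,
      ← mul_assoc (scalar H _) (scalar H _), ← map_mul, inv_mul_cancel, map_one, one_mul]
  choose w hw hww using key
  exact ⟨w, hw, hww⟩

/-- An algebra bundle associated to `lam` is of the form `END(E)`. The lifts of its transition
functions are a `lam`-twisted cocycle on a refinement of `U`; over each `U i` that cocycle can be
untwisted, and it is then trivial because `U i` is contractible. Comparing the trivializations over
`U i` and `U j` gives `E`. -/
theorem exists_isomorphic_END [Nontrivial H] [T2Space X] [ParacompactSpace X]
    (hU : IsGoodCovering U) (lam : NormalizedCocycle U) (A : AlgebraBundle.{u, y, w} X H)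
    (hA : A.IsAssociatedTo lam) :
    ∃ E : TwistedHilbertBundle lam H, A.Isomorphic (E.END hU.toIsOpenCovering) := by
  obtain ⟨S, V, τ, σ, g, η, hV, hτ, hσ, hg, hη, hgA, hgg⟩ := hA
  obtain ⟨w, hw, hww⟩ := exists_untwisting hU lam hV hτ
    (g := fun s r x => g s r x * scalar H (η s r x)⁻¹)
    (fun s r => (hg s r).mul (continuous_scalar.comp_continuousOn (hη s r).inv))
    (fun t s r x hx => by
      have h := hgg t s r x hx
      rw [mul_inv_eq_iff_eq_mul] at h
      calc g t s x * scalar H (η t s x)⁻¹ * (g s r x * scalar H (η s r x)⁻¹)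
          = g t s x * g s r x * (scalar H (η t s x)⁻¹ * scalar H (η s r x)⁻¹) := by
            rw [mul_assoc, ← mul_assoc (scalar H _) (g s r x), ← scalar_mul_comm]
            simp only [mul_assoc]
        _ = g t r x * scalar H ((lam.toFun (τ t) (τ s) (τ r) x *
              (η s r x * (η t r x)⁻¹ * η t s x)) * ((η t s x)⁻¹ * (η s r x)⁻¹)) := by
            rw [h, ← scalar_mul_comm, mul_assoc]
            simp only [← map_mul]
        _ = g t r x * scalar H ((η t r x)⁻¹ * lam.toFun (τ t) (τ s) (τ r) x) := by
            congr 2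
            rw [show lam.toFun (τ t) (τ s) (τ r) x * (η s r x * (η t r x)⁻¹ * η t s x) *
              ((η t s x)⁻¹ * (η s r x)⁻¹) = (η t r x)⁻¹ * lam.toFun (τ t) (τ s) (τ r) x *
              (η s r x * (η s r x)⁻¹) * (η t s x * (η t s x)⁻¹) by
                simp only [mul_assoc, mul_comm, mul_left_comm]]
            simp
        _ = _ := by rw [map_mul, mul_assoc])
  have hconj : ∀ i s r, ∀ x ∈ V r ∩ V s ∩ U i,
      A.trans (σ s) (σ r) x * conj H (w i r x) = conj H (w i s x) := fun i s r x hx => by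
    have h := congrArg (conj H) (hww i s r x hx)
    simp only [map_mul, conj_scalar, mul_one] at h
    rw [hgA s r x hx.1, h]
  choose ρ hρ using hV.covers
  let e : ι → ι → S → X → UnitaryGroup H := fun n m s x =>
    (w n s x)⁻¹ * w m s x * scalar H (lam.toFun n m (τ s) x)
  have hind : ∀ n m s r, ∀ x ∈ V r ∩ V s ∩ (U n ∩ U m), e n m r x = e n m s x :=
    fun n m s r x hx => by
      have h1 := hww n s r x ⟨hx.1, hx.2.1⟩
      have h2 := hww m s r x ⟨hx.1, hx.2.2⟩
      have h3 := lam.cocycle n m (τ s) (τ r) x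
        ⟨⟨⟨hτ r hx.1.1, hτ s hx.1.2⟩, hx.2.2⟩, hx.2.1⟩
      have h4 : (w n r x)⁻¹ * w m r x =
          (w n s x * scalar H (lam.toFun n (τ s) (τ r) x))⁻¹ *
            (w m s x * scalar H (lam.toFun m (τ s) (τ r) x)) := by
        rw [← h1, ← h2]; group
      have h5 : (w n s x)⁻¹ * w m s x * scalar H (lam.toFun m (τ s) (τ r) x) =
          scalar H (lam.toFun m (τ s) (τ r) x) * ((w n s x)⁻¹ * w m s x) := scalar_mul_comm _ _ _
      simp only [e]
      rw [h4, mul_inv_rev, mul_assoc (scalar H _)⁻¹, ← mul_assoc (w n s x)⁻¹, h5, ← map_inv,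
        ← mul_assoc, ← map_mul, ← scalar_mul_comm, mul_assoc, ← map_mul]
      congr 2
      rw [mul_assoc, ← h3, mul_comm (lam.toFun n m (τ s) x), inv_mul_cancel_left]
  let E : TwistedHilbertBundle lam H :=
    { g := fun n m x => e n m (ρ x) x
      continuousOn := fun n m x hx => by
        have h1 : ContinuousOn (e n m (ρ x)) (V (ρ x) ∩ (U m ∩ U n)) :=
          (((hw n _).mono fun z hz => ⟨hz.1, hz.2.2⟩).inv.mul
            ((hw m _).mono fun z hz => ⟨hz.1, hz.2.1⟩)).mul
            (continuous_scalar.comp_continuousOn ((lam.continuousOn n m _).mono fun z hz =>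
              ⟨⟨hτ _ hz.1, hz.2.1⟩, hz.2.2⟩))
        have hmem : V (ρ x) ∩ (U m ∩ U n) ∈ 𝓝[U m ∩ U n] x :=
          inter_mem (mem_nhdsWithin_of_mem_nhds ((hV.isOpen _).mem_nhds (hρ x)))
            self_mem_nhdsWithin
        refine ((h1 x ⟨hρ x, hx⟩).mono_of_mem_nhdsWithin hmem).congr_of_eventuallyEq ?_ rfl
        filter_upwards [hmem] with z hz using
          hind n m (ρ x) (ρ z) z ⟨⟨hρ z, hz.1⟩, hz.2.2, hz.2.1⟩
      self := fun i x hx => by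
        simp [e, lam.eq_one_left i (τ (ρ x)) x ⟨hτ _ (hρ x), hx⟩]
      symm := fun n m x hx => by
        have h := lam.swap_left m n (τ (ρ x)) x ⟨⟨hτ _ (hρ x), hx.2⟩, hx.1⟩
        simp only [e]
        rw [h, scalar_mul_comm, map_inv, mul_inv_rev, mul_inv_rev, inv_inv]
      twisted := fun k j i x hx => by
        have h := lam.cocycle k j i (τ (ρ x)) x ⟨⟨⟨hτ _ (hρ x), hx.1.1⟩, hx.1.2⟩, hx.2⟩
        simp only [e]
        rw [mul_assoc ((w k (ρ x) x)⁻¹ * _), ← scalar_mul_comm,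
          mul_assoc _ (scalar H _) (scalar H _), ← map_mul,
          mul_assoc _ (scalar H _) (scalar H _), ← map_mul,
          mul_comm (lam.toFun k i (τ (ρ x)) x), h, mul_comm (lam.toFun j i (τ (ρ x)) x)]
        group }
  refine ⟨E, fun m a x => (conj H (w m (ρ x) x))⁻¹ * A.trans (σ (ρ x)) a x, fun m a => ?_,
    fun n m a' a x hx => ?_⟩
  · change ContinuousInPU (A.base a ∩ U m) _
    refine continuousInPU_of_local fun x hx => ⟨V (ρ x), hV.isOpen _, hρ x, ?_⟩
    refine ContinuousInPU.congr ((continuousInPU_conj (((hw m (ρ x)).mono fun z hz =>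
      ⟨hz.1, hz.2.2⟩))).inv.mul ((A.continuousInPU (σ (ρ x)) a).mono fun z hz =>
      ⟨hz.2.1, hσ _ hz.1⟩)) fun z hz => ?_
    change (conj H (w m (ρ z) z))⁻¹ * A.trans (σ (ρ z)) a z = _
    rw [← hconj m (ρ z) (ρ x) z ⟨⟨hz.1, hρ z⟩, hz.2.2⟩, mul_inv_rev, mul_assoc,
      ← A.cocycle (σ (ρ z)) (σ (ρ x)) a z ⟨⟨hz.2.1, hσ _ hz.1⟩, hσ _ (hρ z)⟩,
      inv_mul_cancel_left]
  · change (conj H (w n (ρ x) x))⁻¹ * A.trans (σ (ρ x)) a' x * A.trans a' a x =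
      conj H (e n m (ρ x) x) * ((conj H (w m (ρ x) x))⁻¹ * A.trans (σ (ρ x)) a x)
    rw [mul_assoc, A.cocycle _ _ _ x ⟨hx.1, hσ _ (hρ x)⟩]
    simp only [e, map_mul, conj_scalar, mul_one, map_inv]
    group

end Twisted

/-! ### Existence of an associated bundle -/

section Existence

variable {H : Type w} [NormedAddCommGroup H] [InnerProductSpace ℂ H] [CompleteSpace H]

/-- A compact subset of the unitary group can be contracted inside a larger compact subset. -/
theorem exists_contraction (hH : ¬ FiniteDimensional ℂ H) [TopologicalSpace.SeparableSpace H]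
    {C : Set (UnitaryGroup H)} (hC : IsCompact C) :
    ∃ (K : unitInterval × UnitaryGroup H → UnitaryGroup H) (C' : Set (UnitaryGroup H)),
      IsCompact C' ∧ ContinuousOn K (univ ×ˢ C) ∧ (∀ q, K q ∈ C') ∧
      ∀ g ∈ C, K (0, g) = g ∧ K (1, g) = 1 := by
  classical
  have : CompactSpace C := isCompact_iff_compactSpace.1 hC
  obtain ⟨F⟩ := homotopic_one hH (⟨Subtype.val, continuous_subtype_val⟩ : C(C, UnitaryGroup H))
  refine ⟨fun q => if h : q.2 ∈ C then F (q.1, ⟨q.2, h⟩) else 1, range F ∪ {1},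
    (isCompact_range F.continuous).union isCompact_singleton, ?_, fun q => ?_, fun g hg => ?_⟩
  · rw [continuousOn_iff_continuous_domRestrict]
    have h : Continuous fun q : (univ ×ˢ C : Set (unitInterval × UnitaryGroup H)) =>
        F (q.1.1, ⟨q.1.2, q.2.2⟩) := by fun_prop
    refine h.congr fun q => ?_
    simp only [domRestrict_apply, dif_pos q.2.2]
  · dsimp only
    split_ifs
    · exact Or.inl ⟨_, rfl⟩
    · exact Or.inr rfl
  · simp only [dif_pos hg]
    exact ⟨F.apply_zero _, F.apply_one _⟩

variable {X : Type u} [TopologicalSpace X] {ι : Type v}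

/-- A unitary cocycle `a` with relatively compact range on the sets `{ε < ψ i}` becomes trivial on
the smaller sets `{ε' < ψ i}`. The sets are added one by one: on `{ε' < ψ m}` the trivialization
prescribed by the previous sets is cut off by means of a contraction of the unitary group. -/
theorem exists_trivialization_of_compact (hH : ¬ FiniteDimensional ℂ H)
    [TopologicalSpace.SeparableSpace H] {ψ : ι → X → ℝ} (hψ : ∀ i, Continuous (ψ i)) (O : Set X)
    (a : ι → ι → X → UnitaryGroup H) {C : Set (UnitaryGroup H)} (hC : IsCompact C) (ε : ℝ)
    (J : Finset ι)
    (hac : ∀ j ∈ J, ∀ i ∈ J, ContinuousOn (a j i) (O ∩ {x | ε < ψ i x} ∩ {x | ε < ψ j x}))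
    (haC : ∀ j ∈ J, ∀ i ∈ J, ∀ x ∈ O, ε < ψ i x → ε < ψ j x → a j i x ∈ C)
    (haa : ∀ k ∈ J, ∀ j ∈ J, ∀ i ∈ J, ∀ x ∈ O, ε < ψ i x → ε < ψ j x → ε < ψ k x →
      a k j x * a j i x = a k i x) (ε' : ℝ) (hε : ε < ε') :
    ∃ (h : ι → X → UnitaryGroup H) (C' : Set (UnitaryGroup H)), IsCompact C' ∧
      (∀ i ∈ J, ContinuousOn (h i) (O ∩ {x | ε' < ψ i x})) ∧ (∀ i ∈ J, ∀ x ∈ O, ε' < ψ i x →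
        h i x ∈ C') ∧
      ∀ j ∈ J, ∀ i ∈ J, ∀ x ∈ O, ε' < ψ i x → ε' < ψ j x → a j i x * h i x = h j x := by
  classical
  induction J using Finset.induction_on generalizing ε' with
  | empty => exact ⟨fun _ _ => 1, ∅, isCompact_empty, by simp, by simp, by simp⟩
  | insert m J hmJ ih =>
  have hsub : ∀ {i}, i ∈ J → i ∈ insert m J := fun hi => Finset.mem_insert_of_mem hi
  have hm : m ∈ insert m J := Finset.mem_insert_self _ _
  set ε₁ := (ε + ε') / 2 with hε₁
  have h1 : ε < ε₁ := by rw [hε₁]; linarith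
  have h2 : ε₁ < ε' := by rw [hε₁]; linarith
  obtain ⟨h, C₁, hC₁, hhc, hhC, hah⟩ := ih (fun j hj i hi => hac j (hsub hj) i (hsub hi))
    (fun j hj i hi => haC j (hsub hj) i (hsub hi))
    (fun k hk j hj i hi => haa k (hsub hk) j (hsub hj) i (hsub hi)) ε₁ h1
  have haself : ∀ i ∈ insert m J, ∀ x ∈ O, ε < ψ i x → a i i x = 1 := fun i hi x hx hix =>
    mul_eq_left.1 (haa i hi i hi i hi x hx hix hix hix)
  obtain ⟨K, C₂, hC₂, hKc, hKC, hK⟩ := exists_contraction hH (hC.mul hC₁)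
  -- the trivialization over `m` prescribed by the index `i`
  have hind : ∀ i ∈ J, ∀ j ∈ J, ∀ x ∈ O, ε < ψ m x → ε₁ < ψ i x → ε₁ < ψ j x →
      a m i x * h i x = a m j x * h j x := fun i hi j hj x hx hmx hix hjx => by
    rw [← hah j hj i hi x hx hix hjx, ← mul_assoc,
      haa m hm j (hsub hj) i (hsub hi) x hx (h1.trans hix) (h1.trans hjx) hmx]
  let P : X → Prop := fun x => ∃ i ∈ J, ε₁ < ψ i x
  let f : X → UnitaryGroup H := fun x =>
    if hx : P x then a m hx.choose x * h hx.choose x else 1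
  have hf : ∀ i ∈ J, ∀ x ∈ O, ε < ψ m x → ε₁ < ψ i x → f x = a m i x * h i x :=
    fun i hi x hx hmx hix => by
      have hP : P x := ⟨i, hi, hix⟩
      simp only [f, dif_pos hP]
      exact hind _ hP.choose_spec.1 _ hi x hx hmx hP.choose_spec.2 hix
  let μ : X → ℝ := fun x => ∑ i ∈ J, max 0 (ψ i x - ε₁)
  have hμ : Continuous μ := by fun_prop
  have hμ1 : ∀ i ∈ J, ∀ x, ε' < ψ i x → ε' - ε₁ ≤ μ x := fun i hi x hix =>
    le_trans ((by linarith : ε' - ε₁ ≤ ψ i x - ε₁).trans (le_max_right _ _))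
      (Finset.single_le_sum (f := fun i => max 0 (ψ i x - ε₁)) (fun _ _ => le_max_left _ _) hi)
  have hμ0 : ∀ x, ¬ P x → μ x = 0 := fun x hx => Finset.sum_eq_zero fun i hi =>
    max_eq_left (by by_contra hlt; exact hx ⟨i, hi, by linarith⟩)
  let t : X → unitInterval := fun x => projIcc 0 1 zero_le_one (2 - 2 * μ x / (ε' - ε₁))
  have ht : Continuous t := continuous_projIcc.comp (by fun_prop)
  have hpos : 0 < ε' - ε₁ := by linarith
  have ht0 : ∀ x, ε' - ε₁ ≤ μ x → t x = 0 := fun x hx =>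
    projIcc_of_le_left _ (by
      have : 2 ≤ 2 * μ x / (ε' - ε₁) := by rw [le_div_iff₀ hpos]; linarith
      linarith)
  have ht1 : ∀ x, μ x < (ε' - ε₁) / 2 → t x = 1 := fun x hx =>
    projIcc_of_right_le _ (by
      have : 2 * μ x / (ε' - ε₁) ≤ 1 := by rw [div_le_iff₀ hpos]; linarith
      linarith)
  let hm' : X → UnitaryGroup H := fun x => if P x then K (t x, f x) else 1
  have hfC : ∀ x ∈ O, ε < ψ m x → P x → f x ∈ C * C₁ := fun x hx hmx hP => by
    obtain ⟨i, hi, hix⟩ := hP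
    rw [hf i hi x hx hmx hix]
    exact mul_mem_mul (haC m hm i (hsub hi) x hx (h1.trans hix) hmx) (hhC i hi x hx hix)
  have hm'c : ContinuousOn hm' (O ∩ {x | ε' < ψ m x}) := by
    rintro x ⟨hxO, hxm⟩
    by_cases hP : P x
    · obtain ⟨i, hi, hix⟩ := hP
      set s : Set X := O ∩ {x | ε' < ψ m x} ∩ {x | ε₁ < ψ i x} with hs
      have hsn : s ∈ 𝓝[O ∩ {x | ε' < ψ m x}] x :=
        inter_mem self_mem_nhdsWithin (mem_nhdsWithin_of_mem_nhds
          ((isOpen_lt continuous_const (hψ i)).mem_nhds hix))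
      have hcont : ContinuousOn (fun x => K (t x, a m i x * h i x)) s := by
        refine hKc.comp (ht.continuousOn.prodMk (((hac m hm i (hsub hi)).mono ?_).mul
          ((hhc i hi).mono ?_))) ?_
        · exact fun z hz => ⟨⟨hz.1.1, h1.trans hz.2⟩, (h1.trans h2).trans hz.1.2⟩
        · exact fun z hz => ⟨hz.1.1, hz.2⟩
        · exact fun z hz => ⟨mem_univ _, mul_mem_mul
            (haC m hm i (hsub hi) z hz.1.1 (h1.trans hz.2) ((h1.trans h2).trans hz.1.2))
            (hhC i hi z hz.1.1 hz.2)⟩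
      have heq : ∀ z ∈ s, hm' z = K (t z, a m i z * h i z) := fun z hz => by
        have hPz : P z := ⟨i, hi, hz.2⟩
        simp only [hm', if_pos hPz, hf i hi z hz.1.1 ((h1.trans h2).trans hz.1.2) hz.2]
      have hxs : x ∈ s := ⟨⟨hxO, hxm⟩, hix⟩
      refine ((hcont x hxs).mono_of_mem_nhdsWithin hsn).congr_of_eventuallyEq ?_ (heq x hxs)
      filter_upwards [hsn] with z hz using heq z hz
    · have heq : ∀ z ∈ O ∩ {x | ε' < ψ m x}, μ z < (ε' - ε₁) / 2 → hm' z = 1 :=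
        fun z hz hμz => by
          simp only [hm']
          split_ifs with hPz
          · rw [ht1 z hμz]
            exact (hK _ (hfC z hz.1 ((h1.trans h2).trans hz.2) hPz)).2
          · rfl
      have hev : ∀ᶠ z in 𝓝[O ∩ {x | ε' < ψ m x}] x, μ z < (ε' - ε₁) / 2 :=
        mem_nhdsWithin_of_mem_nhds (hμ.continuousAt.eventually_lt_const (by
          rw [hμ0 x hP]; linarith))
      refine (continuousWithinAt_const (b := (1 : UnitaryGroup H))).congr_of_eventuallyEq ?_
        (by simp only [hm', if_neg hP])
      filter_upwards [hev, self_mem_nhdsWithin] with z hz hz' using heq z hz' hz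
  have hm'C : ∀ x, hm' x ∈ C₂ ∪ {1} := fun x => by
    simp only [hm']
    split_ifs
    · exact Or.inl (hKC _)
    · exact Or.inr rfl
  have hm'h : ∀ i ∈ J, ∀ x ∈ O, ε' < ψ i x → ε' < ψ m x → a m i x * h i x = hm' x :=
    fun i hi x hx hix hmx => by
      have hP : P x := ⟨i, hi, h2.trans hix⟩
      have hεm := (h1.trans h2).trans hmx
      simp only [hm', if_pos hP, ht0 x (hμ1 i hi x hix)]
      rw [(hK _ (hfC x hx hεm hP)).1, hf i hi x hx hεm (h2.trans hix)]
  have hne : ∀ {i}, i ∈ J → i ≠ m := fun hi h => hmJ (h ▸ hi)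
  refine ⟨Function.update h m hm', C₁ ∪ (C₂ ∪ {1}), hC₁.union (hC₂.union isCompact_singleton),
    fun i hi => ?_, fun i hi x hx hix => ?_, fun j hj i hi x hx hix hjx => ?_⟩
  · rcases Finset.mem_insert.1 hi with rfl | hi
    · rwa [Function.update_self]
    · rw [Function.update_of_ne (hne hi)]
      exact (hhc i hi).mono fun z hz => ⟨hz.1, h2.trans hz.2⟩
  · rcases Finset.mem_insert.1 hi with rfl | hi
    · rw [Function.update_self]; exact Or.inr (hm'C x)
    · rw [Function.update_of_ne (hne hi)]; exact Or.inl (hhC i hi x hx (h2.trans hix))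
  · rcases Finset.mem_insert.1 hi with rfl | hi' <;> rcases Finset.mem_insert.1 hj with rfl | hj'
    · rw [haself _ hi x hx ((h1.trans h2).trans hix), one_mul]
    · rw [Function.update_self, Function.update_of_ne (hne hj'), ← hm'h j hj' x hx hjx hix,
        ← mul_assoc, haa j hj _ hi j hj x hx ((h1.trans h2).trans hjx) ((h1.trans h2).trans hix)
          ((h1.trans h2).trans hjx), haself j hj x hx ((h1.trans h2).trans hjx), one_mul]
    · rw [Function.update_self, Function.update_of_ne (hne hi'), hm'h i hi' x hx hix hjx]
    · rw [Function.update_of_ne (hne hi'), Function.update_of_ne (hne hj')]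
      exact hah j hj' i hi' x hx (h2.trans hix) (h2.trans hjx)

/-- Over finitely many of the sets `{ε < ψ i}`, where `ψ i` is supported in `U i`, there is a
`lam`-twisted cocycle with relatively compact range. To add a set `{ε < ψ m}`, the twisted cocycle
found for the previous sets is untwisted over `U m`, and the resulting cocycle is trivialized. -/
theorem exists_twisted_of_finset (hH : ¬ FiniteDimensional ℂ H)
    [TopologicalSpace.SeparableSpace H] {U : ι → Set X} (lam : NormalizedCocycle U)
    {ψ : ι → X → ℝ} (hψ : ∀ i, Continuous (ψ i)) (hψU : ∀ i x, 0 < ψ i x → x ∈ U i)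
    (J : Finset ι) (ε : ℝ) (hε : 0 < ε) :
    ∃ (g : ι → ι → X → UnitaryGroup H) (C : Set (UnitaryGroup H)), IsCompact C ∧
      (∀ j ∈ J, ∀ i ∈ J, ContinuousOn (g j i) ({x | ε < ψ i x} ∩ {x | ε < ψ j x})) ∧
      (∀ j ∈ J, ∀ i ∈ J, ∀ x, ε < ψ i x → ε < ψ j x → g j i x ∈ C) ∧
      ∀ k ∈ J, ∀ j ∈ J, ∀ i ∈ J, ∀ x, ε < ψ i x → ε < ψ j x → ε < ψ k x →
        g k j x * g j i x = g k i x * scalar H (lam.toFun k j i x) := by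
  classical
  induction J using Finset.induction_on generalizing ε with
  | empty => exact ⟨fun _ _ _ => 1, ∅, isCompact_empty, by simp, by simp, by simp⟩
  | insert m J hmJ ih =>
  obtain ⟨g, C, hC, hgc, hgC, hgg⟩ := ih (ε / 2) (half_pos hε)
  have hlt : ε / 2 < ε := half_lt_self hε
  have hmemU : ∀ {i x}, ε / 2 < ψ i x → x ∈ U i := fun h => hψU _ _ ((half_pos hε).trans h)
  set R : Set (UnitaryGroup H) := range (scalar H) with hR
  have hRc : IsCompact R := isCompact_range continuous_scalar
  obtain ⟨h, C₁, hC₁, hhc, hhC, hah⟩ := exists_trivialization_of_compact hH hψ {x | ε / 2 < ψ m x}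
    (fun j i x => g j i x * scalar H (lam.toFun m j i x)⁻¹) (hC.mul hRc) (ε / 2) J
    (fun j hj i hi => ((hgc j hj i hi).mono fun x hx => ⟨hx.1.2, hx.2⟩).mul
      (continuous_scalar.comp_continuousOn (ContinuousOn.inv ((lam.continuousOn m j i).mono
        fun x hx => ⟨⟨hmemU hx.1.2, hmemU hx.2⟩, hmemU hx.1.1⟩))))
    (fun j hj i hi x _ hix hjx => mul_mem_mul (hgC j hj i hi x hix hjx) ⟨_, rfl⟩)
    (fun k hk j hj i hi x hx hix hjx hkx => by
      have hl := lam.cocycle m k j i x ⟨⟨⟨hmemU hix, hmemU hjx⟩, hmemU hkx⟩, hmemU hx⟩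
      calc g k j x * scalar H (lam.toFun m k j x)⁻¹ * (g j i x * scalar H (lam.toFun m j i x)⁻¹)
          = g k j x * g j i x * (scalar H (lam.toFun m k j x)⁻¹ *
              scalar H (lam.toFun m j i x)⁻¹) := by
            rw [mul_assoc, ← mul_assoc (scalar H _) (g j i x), ← scalar_mul_comm]
            simp only [mul_assoc]
        _ = g k i x * scalar H (lam.toFun k j i x *
              (lam.toFun m k j x * lam.toFun m j i x)⁻¹) := by
            rw [hgg k hk j hj i hi x hix hjx hkx, mul_assoc]
            simp only [← map_mul, mul_inv]
        _ = _ := by rw [hl, mul_inv, mul_inv_cancel_left]) ε hlt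
  let h' : ι → X → UnitaryGroup H := Function.update h m fun _ => 1
  have hh'm : h' m = fun _ => 1 := Function.update_self ..
  have hh' : ∀ i ∈ J, h' i = h i := fun i hi =>
    Function.update_of_ne (ne_of_mem_of_not_mem hi hmJ) _ _
  have hh'c : ∀ i ∈ insert m J, ContinuousOn (h' i) ({x | ε / 2 < ψ m x} ∩ {x | ε < ψ i x}) :=
    fun i hi => by
      rcases Finset.mem_insert.1 hi with rfl | hi
      · rw [hh'm]; exact continuousOn_const
      · rw [hh' i hi]; exact hhc i hi
  have hh'C : ∀ i ∈ insert m J, ∀ x, ε / 2 < ψ m x → ε < ψ i x → h' i x ∈ C₁ ∪ {1} :=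
    fun i hi x hx hix => by
      rcases Finset.mem_insert.1 hi with rfl | hi
      · rw [hh'm]; exact Or.inr rfl
      · rw [hh' i hi]; exact Or.inl (hhC i hi x hx hix)
  let g' : ι → ι → X → UnitaryGroup H := fun b a x =>
    if b = m ∨ a = m then h' b x * (h' a x)⁻¹ * scalar H (lam.toFun m b a x) else g b a x
  have hg'm : ∀ b a, b = m ∨ a = m →
      g' b a = fun x => h' b x * (h' a x)⁻¹ * scalar H (lam.toFun m b a x) := fun b a hba => by
    funext x; simp only [g', if_pos hba]
  have hg'J : ∀ b a, ¬ (b = m ∨ a = m) → g' b a = g b a := fun b a hba => by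
    funext x; simp only [g', if_neg hba]
  have hmem : ∀ {i}, i ∈ insert m J → i ≠ m → i ∈ J := fun hi hne =>
    (Finset.mem_insert.1 hi).resolve_left hne
  have hm_of : ∀ {b a x}, b = m ∨ a = m → ε < ψ a x → ε < ψ b x → ε / 2 < ψ m x := by
    rintro b a x (rfl | rfl) ha hb
    exacts [hlt.trans hb, hlt.trans ha]
  -- where `{ε < ψ m}` meets the other sets, the new cocycle is the coboundary of `h'`, twisted
  have hg' : ∀ b ∈ insert m J, ∀ a ∈ insert m J, ∀ x, ε / 2 < ψ m x → ε < ψ a x → ε < ψ b x →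
      g' b a x = h' b x * (h' a x)⁻¹ * scalar H (lam.toFun m b a x) :=
    fun b hb a ha x hx hax hbx => by
      by_cases hba : b = m ∨ a = m
      · rw [hg'm b a hba]
      · rw [hg'J b a hba]
        have hb' := hmem hb fun he => hba (Or.inl he)
        have ha' := hmem ha fun he => hba (Or.inr he)
        rw [hh' b hb', hh' a ha', ← hah b hb' a ha' x hx hax hbx, mul_inv_cancel_right, mul_assoc,
          ← map_mul, inv_mul_cancel, map_one, mul_one]
  refine ⟨g', C ∪ (C₁ ∪ {1}) * (C₁ ∪ {1})⁻¹ * R, hC.union (((hC₁.union isCompact_singleton).mul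
    (hC₁.union isCompact_singleton).inv).mul hRc), fun b hb a ha => ?_,
    fun b hb a ha x hax hbx => ?_, fun k hk j hj i hi x hix hjx hkx => ?_⟩
  · by_cases hba : b = m ∨ a = m
    · rw [hg'm b a hba]
      refine (((hh'c b hb).mono fun x hx => ⟨hm_of hba hx.1 hx.2, hx.2⟩).mul
        ((hh'c a ha).mono fun x hx => ⟨hm_of hba hx.1 hx.2, hx.1⟩).inv).mul
        (continuous_scalar.comp_continuousOn ((lam.continuousOn m b a).mono fun x hx =>
          ⟨⟨hmemU (hlt.trans hx.1), hmemU (hlt.trans hx.2)⟩, hmemU (hm_of hba hx.1 hx.2)⟩))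
    · rw [hg'J b a hba]
      exact (hgc b (hmem hb fun he => hba (Or.inl he)) a (hmem ha fun he => hba (Or.inr he))).mono
        fun x hx => ⟨hlt.trans hx.1, hlt.trans hx.2⟩
  · by_cases hba : b = m ∨ a = m
    · rw [hg'm b a hba]
      exact Or.inr (mul_mem_mul (mul_mem_mul (hh'C b hb x (hm_of hba hax hbx) hbx)
        (Set.inv_mem_inv.2 (hh'C a ha x (hm_of hba hax hbx) hax))) ⟨_, rfl⟩)
    · rw [hg'J b a hba]
      exact Or.inl (hgC b (hmem hb fun he => hba (Or.inl he)) a (hmem ha fun he => hba (Or.inr he))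
        x (hlt.trans hax) (hlt.trans hbx))
  · by_cases hkji : k = m ∨ j = m ∨ i = m
    · have hmx : ε / 2 < ψ m x := by
        rcases hkji with rfl | rfl | rfl
        exacts [hlt.trans hkx, hlt.trans hjx, hlt.trans hix]
      have hl := lam.cocycle m k j i x ⟨⟨⟨hmemU (hlt.trans hix), hmemU (hlt.trans hjx)⟩,
        hmemU (hlt.trans hkx)⟩, hmemU hmx⟩
      rw [hg' k hk j hj x hmx hjx hkx, hg' j hj i hi x hmx hix hjx, hg' k hk i hi x hmx hix hkx,
        mul_assoc _ (scalar H _) (scalar H _), ← map_mul, mul_comm (lam.toFun m k i x), ← hl,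
        map_mul, mul_assoc (h' k x * _), ← scalar_mul_comm, ← mul_assoc, ← mul_assoc,
        mul_assoc _ (scalar H _) (scalar H _), ← map_mul, ← map_mul, mul_comm (lam.toFun m j i x)]
      group
    · push Not at hkji
      rw [hg'J k j (not_or.2 ⟨hkji.1, hkji.2.1⟩), hg'J j i (not_or.2 ⟨hkji.2.1, hkji.2.2⟩),
        hg'J k i (not_or.2 ⟨hkji.1, hkji.2.2⟩)]
      exact hgg k (hmem hk hkji.1) j (hmem hj hkji.2.1) i (hmem hi hkji.2.2) x (hlt.trans hix)
        (hlt.trans hjx) (hlt.trans hkx)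

/-- Every cocycle `lam` of a finite covering has an associated algebra bundle. -/
theorem exists_associated [T2Space X] [ParacompactSpace X] (hH : ¬ FiniteDimensional ℂ H)
    [TopologicalSpace.SeparableSpace H] [Finite ι] {U : ι → Set X} (hU : IsOpenCovering U)
    (lam : NormalizedCocycle U) :
    ∃ A : AlgebraBundle.{u, v, w} X H, A.IsAssociatedTo lam := by
  have := Fintype.ofFinite ι
  obtain ⟨φ, hφ⟩ := PartitionOfUnity.exists_isSubordinate isClosed_univ U hU.isOpen
    fun x _ => mem_iUnion.2 (hU.covers x)
  -- among `n` nonnegative numbers with sum `1` there is one larger than `1 / (2 n)`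
  let ψ : ι → X → ℝ := fun i x => Fintype.card ι * φ i x
  have hψ : ∀ i, Continuous (ψ i) := fun i => continuous_const.mul (φ i).continuous
  have hψU : ∀ i x, 0 < ψ i x → x ∈ U i := fun i x hx =>
    hφ i (subset_tsupport _ fun h0 => by simp [ψ, h0] at hx)
  have hcov : ∀ x, ∃ i, 1 / 2 < ψ i x := fun x => by
    by_contra! hle
    have h1 : ∑ i, φ i x = 1 := by
      rw [← finsum_eq_sum_of_fintype]; exact φ.sum_eq_one (mem_univ x)
    have h2 : ∑ i, ψ i x ≤ Fintype.card ι * (1 / 2) :=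
      (Finset.sum_le_card_nsmul _ _ _ fun i _ => hle i).trans (by simp)
    have h3 : (0 : ℝ) < Fintype.card ι := by
      obtain ⟨i, -⟩ := hU.covers x
      exact_mod_cast Fintype.card_pos_iff.2 ⟨i⟩
    rw [← Finset.mul_sum, h1] at h2
    linarith
  obtain ⟨g, -, -, hgc, -, hgg⟩ := exists_twisted_of_finset hH lam hψ hψU Finset.univ (1 / 2)
    one_half_pos
  let V : ι → Set X := fun i => {x | 1 / 2 < ψ i x}
  have hVU : ∀ i, V i ⊆ U i := fun i x hx => hψU i x (one_half_pos.trans hx)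
  have hV : IsOpenCovering V := ⟨fun i => isOpen_lt continuous_const (hψ i), hcov⟩
  have hgg' : ∀ k j i, ∀ x ∈ V i ∩ V j ∩ V k,
      g k j x * g j i x = g k i x * scalar H (lam.toFun k j i x) := fun k j i x hx =>
    hgg k (Finset.mem_univ _) j (Finset.mem_univ _) i (Finset.mem_univ _) x hx.1.1 hx.1.2 hx.2
  choose ρ hρ using hV.covers
  refine ⟨{ Index := ι
            base := V
            covering := hV
            trans := fun b a x => conj H (g b a x)
            continuousInPU := fun b a =>
              continuousInPU_conj (hgc b (Finset.mem_univ _) a (Finset.mem_univ _))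
            cocycle := fun c b a x hx => by
              rw [← map_mul, hgg' c b a x hx, map_mul, conj_scalar, mul_one] },
    X, fun x => V (ρ x), ρ, ρ, fun y x => g (ρ y) (ρ x), fun _ _ _ => 1,
    ⟨fun x => hV.isOpen _, fun x => ⟨x, hρ x⟩⟩, fun x => hVU _, fun x => subset_rfl,
    fun y x => hgc _ (Finset.mem_univ _) _ (Finset.mem_univ _), fun _ _ => continuousOn_const,
    fun _ _ _ _ => rfl, fun z y x p hp => ?_⟩
  rw [hgg' _ _ _ p hp, scalar_mul_comm, mul_inv_cancel_right]
  simp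

end Existence

/-! ### Uniqueness of the associated bundle -/

/-- Continuity on a set can be checked on the pieces of a finite closed cover. -/
theorem continuousOn_of_finite_cover {Y Z : Type*} [TopologicalSpace Y] [TopologicalSpace Z]
    {κ : Type*} [Finite κ] {s : Set Y} {C : κ → Set Y} (hC : ∀ k, IsClosed (C k))
    (hs : s ⊆ ⋃ k, C k) {f : Y → Z} (hf : ∀ k, ContinuousOn f (s ∩ C k)) : ContinuousOn f s := by
  intro p hp
  have hs' : s ⊆ ⋃ k, s ∩ C k := by rw [← inter_iUnion]; exact subset_inter subset_rfl hs
  refine ContinuousWithinAt.mono ?_ hs'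
  rw [ContinuousWithinAt, nhdsWithin_iUnion, tendsto_iSup]
  intro k
  by_cases hpk : p ∈ C k
  · exact hf k p ⟨hp, hpk⟩
  · refine continuousWithinAt_of_notMem_closure fun h => hpk ?_
    exact (hC k).closure_subset (closure_mono inter_subset_right h)

section Simplex

variable {ι : Type v}

/-- The simplex with vertices `T`, as a set of functions on `ι`. It is empty for `T = ∅`. -/
def simplex (T : Finset ι) : Set (ι → ℝ) :=
  {t | (∀ i, 0 ≤ t i) ∧ (∀ i ∉ T, t i = 0) ∧ ∑ i ∈ T, t i = 1}

/-- The boundary of `simplex T`. -/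
def simplexBoundary (T : Finset ι) : Set (ι → ℝ) :=
  simplex T ∩ ⋃ i : T, {t | t i = 0}

theorem isClosed_simplex (T : Finset ι) : IsClosed (simplex T) := by
  have h1 : IsClosed {t : ι → ℝ | ∀ i, 0 ≤ t i} := by
    simp only [ofPred_forall]
    exact isClosed_iInter fun i => isClosed_le continuous_const (continuous_apply i)
  have h2 : IsClosed {t : ι → ℝ | ∀ i ∉ T, t i = 0} := by
    simp only [ofPred_forall]
    exact isClosed_iInter fun i => isClosed_iInter fun _ =>
      isClosed_eq (continuous_apply i) continuous_const
  have h3 : IsClosed {t : ι → ℝ | ∑ i ∈ T, t i = 1} :=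
    isClosed_eq (by fun_prop) continuous_const
  exact h1.inter (h2.inter h3)

theorem isCompact_simplexBoundary (T : Finset ι) : IsCompact (simplexBoundary T) := by
  refine (isCompact_univ_pi fun _ : ι => isCompact_Icc (a := (0 : ℝ)) (b := 1)).of_isClosed_subset
    ((isClosed_simplex T).inter (isClosed_iUnion_of_finite fun i =>
      isClosed_eq (continuous_apply _) continuous_const)) fun t ht i _ => ⟨ht.1.1 i, ?_⟩
  by_cases hi : i ∈ T
  · rw [← ht.1.2.2]
    exact Finset.single_le_sum (fun j _ => ht.1.1 j) hi
  · rw [ht.1.2.1 i hi]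
    exact zero_le_one

theorem mem_simplex_of_subset [DecidableEq ι] {S T : Finset ι} {t : ι → ℝ} (hST : S ⊆ T)
    (ht : t ∈ simplex T) (h0 : ∀ i ∈ T, i ∉ S → t i = 0) : t ∈ simplex S := by
  refine ⟨ht.1, fun i hi => ?_, ?_⟩
  · by_cases hiT : i ∈ T
    exacts [h0 i hiT hi, ht.2.1 i hiT]
  · rw [← ht.2.2]
    exact Finset.sum_subset hST h0

variable {H : Type w} [NormedAddCommGroup H] [InnerProductSpace ℂ H] [CompleteSpace H]
  {X : Type u} [TopologicalSpace X]

/-- A map to the unitary group from the product of a compact set and a contractible set contracts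
to a constant map. -/
theorem exists_contraction_of_contractible (hH : ¬ FiniteDimensional ℂ H)
    [TopologicalSpace.SeparableSpace H] {Y : Type*} [TopologicalSpace Y] {B : Set Y}
    (hB : IsCompact B) {D : Set X} [ContractibleSpace D] {f : Y × X → UnitaryGroup H}
    (hf : ContinuousOn f (B ×ˢ D)) :
    ∃ N : unitInterval × (Y × X) → UnitaryGroup H, ContinuousOn N (univ ×ˢ (B ×ˢ D)) ∧
      ∀ p ∈ B ×ˢ D, N (0, p) = f p ∧ N (1, p) = 1 := by
  classical
  have : CompactSpace B := isCompact_iff_compactSpace.1 hB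
  let f' : C(B × D, UnitaryGroup H) := ⟨fun q => f (q.1, q.2),
    hf.comp_continuous (by fun_prop) fun q => ⟨q.1.2, q.2.2⟩⟩
  obtain ⟨y, hy⟩ := id_nullhomotopic D
  have h1 : f'.Homotopic 1 := by
    have h2 : f'.Homotopic ((f'.comp (ContinuousMap.prodMk (.id B) (.const B y))).comp .fst) := by
      have h3 : (ContinuousMap.id (B × D)).Homotopic
          (ContinuousMap.prodMap (.id B) (.const D y)) :=
        ContinuousMap.Homotopic.prodMap (.refl (.id B)) hy
      exact (ContinuousMap.Homotopic.refl f').comp h3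
    have h4 := homotopic_one hH (f'.comp (ContinuousMap.prodMk (.id B) (.const B y)))
    exact h2.trans (h4.comp (.refl ContinuousMap.fst))
  obtain ⟨F⟩ := h1
  refine ⟨fun q => if h : q.2 ∈ B ×ˢ D then F (q.1, (⟨q.2.1, h.1⟩, ⟨q.2.2, h.2⟩)) else 1, ?_,
    fun p hp => ?_⟩
  · rw [continuousOn_iff_continuous_domRestrict]
    have h : Continuous fun q : (univ ×ˢ (B ×ˢ D) : Set (unitInterval × (Y × X))) =>
        F (q.1.1, (⟨q.1.2.1, q.2.2.1⟩, ⟨q.1.2.2, q.2.2.2⟩)) := by fun_prop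
    refine h.congr fun q => ?_
    simp only [domRestrict_apply, dif_pos q.2.2]
  · simp only [dif_pos hp]
    exact ⟨F.apply_zero _, F.apply_one _⟩

/-- A family of maps from the boundary of a simplex to the unitary group, parametrized by a
contractible set, extends to the simplex. -/
theorem exists_extension_simplex (hH : ¬ FiniteDimensional ℂ H)
    [TopologicalSpace.SeparableSpace H] {T : Finset ι} (hT : T.Nonempty) {D : Set X}
    [ContractibleSpace D] {f : (ι → ℝ) × X → UnitaryGroup H}
    (hf : ContinuousOn f (simplexBoundary T ×ˢ D)) :
    ∃ F : (ι → ℝ) × X → UnitaryGroup H, ContinuousOn F (simplex T ×ˢ D) ∧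
      EqOn F f (simplexBoundary T ×ˢ D) := by
  classical
  obtain ⟨N, hNc, hN⟩ := exists_contraction_of_contractible hH (isCompact_simplexBoundary T) hf
  -- `m` is, up to a factor, the barycentric height over the boundary, and `r` is the radial
  -- projection from the barycentre, where `m = 1`
  let m : (ι → ℝ) → ℝ := fun t => T.card * T.inf' hT t
  have hm : Continuous m :=
    continuous_const.mul (Continuous.finset_inf'_apply hT fun i _ => continuous_apply i)
  have hcard : (0 : ℝ) < T.card := by exact_mod_cast hT.card_pos
  let r : (ι → ℝ) → ι → ℝ := fun t i => if i ∈ T then (t i - T.inf' hT t) / (1 - m t) else 0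
  have hr : ContinuousOn r {t | m t < 1} := by
    refine continuousOn_pi.2 fun i => ?_
    by_cases hi : i ∈ T
    · simp only [r, if_pos hi]
      exact (Continuous.continuousOn ((continuous_apply i).sub
        (Continuous.finset_inf'_apply hT fun i _ => continuous_apply i))).div
        (continuous_const.sub hm).continuousOn fun t ht => (sub_pos.2 ht).ne'
    · simp only [r, if_neg hi]
      exact continuousOn_const
  have hrB : ∀ t ∈ simplex T, m t < 1 → r t ∈ simplexBoundary T := fun t ht hmt => by
    refine ⟨⟨fun i => ?_, fun i hi => if_neg hi, ?_⟩, ?_⟩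
    · by_cases hi : i ∈ T
      · simp only [r, if_pos hi]
        exact div_nonneg (sub_nonneg.2 (Finset.inf'_le _ hi)) (sub_pos.2 hmt).le
      · simp only [r, if_neg hi, le_refl]
    · have h1 : ∀ i ∈ T, r t i = (t i - T.inf' hT t) / (1 - m t) := fun i hi => if_pos hi
      rw [Finset.sum_congr rfl h1, ← Finset.sum_div, Finset.sum_sub_distrib, ht.2.2,
        Finset.sum_const, nsmul_eq_mul]
      exact div_self (sub_pos.2 hmt).ne'
    · obtain ⟨i, hi, hit⟩ := Finset.exists_mem_eq_inf' hT t
      refine mem_iUnion.2 ⟨⟨i, hi⟩, ?_⟩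
      change r t i = 0
      simp only [r, if_pos hi, ← hit, sub_self, zero_div]
  have hmB : ∀ t ∈ simplexBoundary T, m t = 0 ∧ r t = t := fun t ht => by
    obtain ⟨⟨i, hi⟩, h0⟩ := mem_iUnion.1 ht.2
    have h1 : T.inf' hT t = 0 :=
      le_antisymm ((Finset.inf'_le _ hi).trans_eq h0) (Finset.le_inf' _ _ fun j _ => ht.1.1 j)
    have h2 : m t = 0 := by simp only [m, h1, mul_zero]
    refine ⟨h2, funext fun j => ?_⟩
    by_cases hj : j ∈ T
    · simp only [r, if_pos hj, h1, h2, sub_zero, div_one]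
    · simp only [r, if_neg hj, ht.1.2.1 j hj]
  let c : (ι → ℝ) → unitInterval := fun t => projIcc 0 1 zero_le_one (2 * m t)
  have hc : Continuous c := continuous_projIcc.comp (continuous_const.mul hm)
  have hc1 : ∀ t, 1 / 2 < m t → c t = 1 := fun t ht => projIcc_of_right_le _ (by linarith)
  let F : (ι → ℝ) × X → UnitaryGroup H := fun p =>
    if m p.1 < 1 then N (c p.1, (r p.1, p.2)) else 1
  have hm' : Continuous fun p : (ι → ℝ) × X => m p.1 := hm.comp continuous_fst
  refine ⟨F, fun p hp => ?_, fun p hp => ?_⟩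
  · by_cases hp1 : m p.1 < 1
    · have hmem : (simplex T ×ˢ D) ∩ {p | m p.1 < 1} ∈ 𝓝[simplex T ×ˢ D] p :=
        inter_mem self_mem_nhdsWithin (mem_nhdsWithin_of_mem_nhds
          ((isOpen_lt hm' continuous_const).mem_nhds hp1))
      have h1 : ContinuousOn (fun p : (ι → ℝ) × X => N (c p.1, (r p.1, p.2)))
          ((simplex T ×ˢ D) ∩ {p | m p.1 < 1}) := by
        refine hNc.comp ((hc.comp continuous_fst).continuousOn.prodMk
          ((hr.comp continuous_fst.continuousOn fun q hq => hq.2).prodMk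
            continuous_snd.continuousOn)) fun q hq => ?_
        exact ⟨mem_univ _, hrB _ hq.1.1 hq.2, hq.1.2⟩
      refine ((h1 p ⟨hp, hp1⟩).mono_of_mem_nhdsWithin hmem).congr_of_eventuallyEq ?_ (if_pos hp1)
      filter_upwards [hmem] with q hq using if_pos hq.2
    · have h1 : ∀ q ∈ simplex T ×ˢ D, 1 / 2 < m q.1 → F q = 1 := fun q hq hmq => by
        simp only [F]
        split_ifs with hq1
        · rw [hc1 _ hmq]
          exact (hN (r q.1, q.2) ⟨hrB _ hq.1 hq1, hq.2⟩).2
        · rfl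
      refine (continuousWithinAt_const (b := (1 : UnitaryGroup H))).congr_of_eventuallyEq ?_
        (if_neg hp1)
      filter_upwards [self_mem_nhdsWithin, mem_nhdsWithin_of_mem_nhds
        (hm'.continuousAt.eventually_const_lt (u := 1 / 2) (by linarith))] with q hq hmq
        using h1 q hq hmq
  · obtain ⟨h0, hrp⟩ := hmB p.1 hp.1
    have hc0 : c p.1 = 0 := by
      refine projIcc_of_le_left _ ?_
      rw [h0, mul_zero]
    simp only [F, h0, zero_lt_one, if_true, hc0, hrp]
    exact (hN p hp).1

end Simplex

section Uniqueness

variable {H : Type w} [NormedAddCommGroup H] [InnerProductSpace ℂ H] [CompleteSpace H]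
  {X : Type u} [TopologicalSpace X] {ι : Type v} {U : ι → Set X} {lam : NormalizedCocycle U}

/-- The cocycle `lam` is invariant under cyclic permutations of the indices. -/
theorem NormalizedCocycle.rotate {k j i : ι} {x : X} (hx : x ∈ U i ∩ U j ∩ U k) :
    lam.toFun j i k x = lam.toFun k j i x := by
  rw [lam.swap_right j k i x ⟨⟨hx.1.1, hx.2⟩, hx.1.2⟩, lam.swap_left k j i x hx, inv_inv]

/-- The isomorphisms from `E` to `E'` are the sections of a fibre bundle over `X`. Over the `n`-th
skeleton of the nerve of the covering there is a family of such isomorphisms: `Φ i (t, x)` is an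
isomorphism over `x`, in the chart `i`, where `t` is a point of the face of the nerve formed by sets
`U i` containing `x`. It is built by induction on the skeleta, as the intersections of the sets
`U i` are contractible. -/
theorem exists_isomorphism_skeleton [Fintype ι] [Nonempty ι] (hH : ¬ FiniteDimensional ℂ H)
    [TopologicalSpace.SeparableSpace H] (hU : IsGoodCovering U) (E E' : TwistedHilbertBundle lam H)
    (n : ℕ) :
    ∃ Φ : ι → (ι → ℝ) × X → UnitaryGroup H, ∀ T : Finset ι, T.card ≤ n →
      (∀ i, ContinuousOn (Φ i) (simplex T ×ˢ ((⋂ k ∈ T, U k) ∩ U i))) ∧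
      ∀ t ∈ simplex T, ∀ x ∈ ⋂ k ∈ T, U k, ∀ j i, x ∈ U i → x ∈ U j →
        Φ j (t, x) * E.g j i x = E'.g j i x * Φ i (t, x) := by
  classical
  induction n with
  | zero =>
    refine ⟨fun _ _ => 1, fun T hT => ⟨fun _ => continuousOn_const, fun t ht => ?_⟩⟩
    have h1 := ht.2.2
    rw [Finset.card_eq_zero.1 (Nat.le_zero.1 hT), Finset.sum_empty] at h1
    exact absurd h1 zero_ne_one
  | succ n ih =>
  obtain ⟨Φ, hΦ⟩ := ih
  have hface : ∀ {T : Finset ι} {k}, T.card = n + 1 → k ∈ T → (T.erase k).card ≤ n :=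
    fun hT hk => by rw [Finset.card_erase_of_mem hk, hT]; rfl
  have hmono : ∀ {S T : Finset ι}, S ⊆ T → (⋂ k ∈ T, U k) ⊆ ⋂ k ∈ S, U k :=
    fun hST => biInter_subset_biInter_left hST
  have hext : ∀ T : Finset ι, T.card = n + 1 → ∃ i₀ ∈ T, ∃ F : (ι → ℝ) × X → UnitaryGroup H,
      ContinuousOn F (simplex T ×ˢ ⋂ k ∈ T, U k) ∧
      EqOn F (Φ i₀) (simplexBoundary T ×ˢ ⋂ k ∈ T, U k) := fun T hT => by
    have hne : T.Nonempty := Finset.card_pos.1 (by omega)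
    obtain ⟨i₀, hi₀⟩ := id hne
    refine ⟨i₀, hi₀, ?_⟩
    rcases (⋂ k ∈ T, U k).eq_empty_or_nonempty with h0 | h0
    · exact ⟨fun _ => 1, continuousOn_const, fun p hp => by simp [h0] at hp⟩
    have := hU.contractible T hne h0
    refine exists_extension_simplex hH hne (continuousOn_of_finite_cover
      (C := fun k : T => {p : (ι → ℝ) × X | p.1 k = 0})
      (fun k => isClosed_eq (by fun_prop) continuous_const) ?_ fun k => ?_)
    · exact fun p hp => mem_iUnion.2 ((mem_iUnion.1 hp.1.2).imp fun _ h => h)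
    · refine ((hΦ _ (hface hT k.2)).1 i₀).mono fun p hp => ⟨?_, hmono (Finset.erase_subset _ _)
        hp.1.2, mem_iInter₂.1 hp.1.2 i₀ hi₀⟩
      refine mem_simplex_of_subset (Finset.erase_subset _ _) hp.1.1.1 fun i hi hi' => ?_
      have : i = k := by
        by_contra hne
        exact hi' (Finset.mem_erase.2 ⟨hne, hi⟩)
      rw [this]
      exact hp.2
  choose! i₀ hi₀ F hFc hF using hext
  let supp : (ι → ℝ) → Finset ι := fun t => Finset.univ.filter fun i => t i ≠ 0
  have hsupp : ∀ {T t}, t ∈ simplex T → supp t ⊆ T := fun ht i hi => by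
    by_contra hiT
    exact (Finset.mem_filter.1 hi).2 (ht.2.1 i hiT)
  have hsupp_mem : ∀ {T t}, t ∈ simplex T → t ∈ simplex (supp t) := fun ht =>
    mem_simplex_of_subset (hsupp ht) ht fun i _ hi => by
      by_contra hne
      exact hi (Finset.mem_filter.2 ⟨Finset.mem_univ _, hne⟩)
  let G : Finset ι → ι → (ι → ℝ) × X → UnitaryGroup H := fun T i p =>
    E'.g i (i₀ T) p.2 * F T p * E.g (i₀ T) i p.2
  let Φ' : ι → (ι → ℝ) × X → UnitaryGroup H := fun i p =>
    if (supp p.1).card = n + 1 then G (supp p.1) i p else Φ i p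
  have hlow : ∀ T : Finset ι, T.card ≤ n → ∀ t ∈ simplex T, ∀ i x, Φ' i (t, x) = Φ i (t, x) :=
    fun T hT t ht i x => if_neg fun h => by
      have h1 : (supp t).card = n + 1 := h
      have h2 := Finset.card_le_card (hsupp ht)
      omega
  have hhigh : ∀ T : Finset ι, T.card = n + 1 → ∀ t ∈ simplex T, ∀ x ∈ ⋂ k ∈ T, U k, ∀ i,
      x ∈ U i → Φ' i (t, x) = G T i (t, x) := fun T hT t ht x hx i hxi => by
    have hsT := hsupp ht
    by_cases hs : (supp t).card = n + 1
    · have : supp t = T := Finset.eq_of_subset_of_card_le hsT (by rw [hs, hT])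
      change (if (supp t).card = n + 1 then G (supp t) i (t, x) else Φ i (t, x)) = _
      rw [if_pos hs, this]
    · have hle : (supp t).card ≤ n := by
        have := Finset.card_le_card hsT
        omega
      have hxi₀ : x ∈ U (i₀ T) := mem_iInter₂.1 hx _ (hi₀ T hT)
      have hbd : t ∈ simplexBoundary T := by
        refine ⟨ht, ?_⟩
        have hne : supp t ≠ T := fun h => hs (by rw [h, hT])
        obtain ⟨k, hkT, hk⟩ := Finset.exists_of_ssubset (hsT.ssubset_of_ne hne)
        refine mem_iUnion.2 ⟨⟨k, hkT⟩, ?_⟩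
        by_contra h0
        exact hk (Finset.mem_filter.2 ⟨Finset.mem_univ _, h0⟩)
      have h1 := (hΦ _ hle).2 t (hsupp_mem ht) x (hmono hsT hx) i (i₀ T) hxi₀ hxi
      change (if (supp t).card = n + 1 then G (supp t) i (t, x) else Φ i (t, x)) = _
      rw [if_neg hs]
      change _ = E'.g i (i₀ T) x * F T (t, x) * E.g (i₀ T) i x
      rw [hF T hT ⟨hbd, hx⟩, ← h1, mul_assoc, E.symm (i₀ T) i x ⟨hxi, hxi₀⟩, mul_inv_cancel,
        mul_one]
  refine ⟨Φ', fun T hT => ?_⟩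
  rcases Nat.le_succ_iff.1 hT with hT | hT
  · refine ⟨fun i => ((hΦ T hT).1 i).congr fun p hp => hlow T hT p.1 hp.1 i p.2,
      fun t ht x hx j i hi hj => ?_⟩
    rw [hlow T hT t ht, hlow T hT t ht]
    exact (hΦ T hT).2 t ht x hx j i hi hj
  · have hi₀U : ∀ {x}, x ∈ ⋂ k ∈ T, U k → x ∈ U (i₀ T) := fun hx =>
      mem_iInter₂.1 hx _ (hi₀ T hT)
    refine ⟨fun i => ContinuousOn.congr ?_ fun p hp =>
      hhigh T hT p.1 hp.1 p.2 hp.2.1 i hp.2.2, fun t ht x hx j i hi hj => ?_⟩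
    · refine (((E'.continuousOn i (i₀ T)).comp continuous_snd.continuousOn fun p hp => ?_).mul
        ((hFc T hT).mono fun p hp => ⟨hp.1, hp.2.1⟩)).mul
        ((E.continuousOn (i₀ T) i).comp continuous_snd.continuousOn fun p hp => ?_)
      · exact ⟨hi₀U hp.2.1, hp.2.2⟩
      · exact ⟨hp.2.2, hi₀U hp.2.1⟩
    · have hx₀ := hi₀U hx
      rw [hhigh T hT t ht x hx j hj, hhigh T hT t ht x hx i hi]
      change E'.g j (i₀ T) x * F T (t, x) * E.g (i₀ T) j x * E.g j i x =
        E'.g j i x * (E'.g i (i₀ T) x * F T (t, x) * E.g (i₀ T) i x)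
      rw [mul_assoc, E.twisted (i₀ T) j i x ⟨⟨hi, hj⟩, hx₀⟩, ← mul_assoc (E'.g j i x),
        ← mul_assoc (E'.g j i x), E'.twisted j i (i₀ T) x ⟨⟨hx₀, hi⟩, hj⟩,
        NormalizedCocycle.rotate ⟨⟨hi, hj⟩, hx₀⟩, mul_assoc _ (scalar H _) (F T (t, x)),
        ← scalar_mul_comm, scalar_mul_comm H _ (E.g (i₀ T) i x)]
      simp only [mul_assoc]

/-- Two `lam`-twisted Hilbert bundles on a good covering are isomorphic. The isomorphism is the
pullback, by a partition of unity, of the family of isomorphisms over the nerve. -/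
theorem exists_isomorphism [T2Space X] [ParacompactSpace X] (hH : ¬ FiniteDimensional ℂ H)
    [TopologicalSpace.SeparableSpace H] (hU : IsGoodCovering U)
    (E E' : TwistedHilbertBundle lam H) :
    ∃ h : ι → X → UnitaryGroup H, (∀ i, ContinuousOn (h i) (U i)) ∧
      ∀ j i, ∀ x ∈ U i ∩ U j, h j x * E.g j i x = E'.g j i x * h i x := by
  classical
  have := hU.finite
  have := Fintype.ofFinite ι
  rcases isEmpty_or_nonempty ι with hι | hι
  · exact ⟨fun i => isEmptyElim i, fun i => isEmptyElim i, fun i => isEmptyElim i⟩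
  obtain ⟨Φ, hΦ⟩ := exists_isomorphism_skeleton hH hU E E' (Fintype.card ι)
  obtain ⟨φ, hφ⟩ := PartitionOfUnity.exists_isSubordinate isClosed_univ U hU.isOpen
    fun x _ => mem_iUnion.2 (hU.covers x)
  let t : X → ι → ℝ := fun x i => φ i x
  have ht : Continuous t := continuous_pi fun i => (φ i).continuous
  let C : Finset ι → Set X := fun T => {x | ∀ k ∉ T, φ k x = 0} ∩ ⋂ k ∈ T, tsupport (φ k)
  have hC : ∀ T, IsClosed (C T) := fun T => by
    refine .inter ?_ (isClosed_biInter fun k _ => isClosed_tsupport _)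
    simp only [ofPred_forall]
    exact isClosed_iInter fun k => isClosed_iInter fun _ =>
      isClosed_eq (φ k).continuous continuous_const
  have hCU : ∀ {T x}, x ∈ C T → x ∈ ⋂ k ∈ T, U k := fun hx =>
    mem_iInter₂.2 fun k hk => hφ k (mem_iInter₂.1 hx.2 k hk)
  have hCt : ∀ {T x}, x ∈ C T → t x ∈ simplex T := fun {T x} hx => by
    refine ⟨fun i => φ.nonneg i x, hx.1, ?_⟩
    rw [Finset.sum_subset (Finset.subset_univ T) fun i _ hi => hx.1 i hi,
      ← finsum_eq_sum_of_fintype]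
    exact φ.sum_eq_one (mem_univ x)
  have hCcov : ∀ x, ∃ T, x ∈ C T := fun x => by
    refine ⟨Finset.univ.filter fun k => x ∈ tsupport (φ k), fun k hk => ?_,
      mem_iInter₂.2 fun k hk => (Finset.mem_filter.1 hk).2⟩
    by_contra h0
    exact hk (Finset.mem_filter.2 ⟨Finset.mem_univ _, subset_tsupport _ h0⟩)
  refine ⟨fun i x => Φ i (t x, x), fun i => ?_, fun j i x hx => ?_⟩
  · refine continuousOn_of_finite_cover hC (fun x _ => mem_iUnion.2 (hCcov x)) fun T => ?_
    exact ((hΦ T T.card_le_univ).1 i).comp (ht.prodMk continuous_id).continuousOn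
      fun x hx => ⟨hCt hx.2, hCU hx.2, hx.1⟩
  · obtain ⟨T, hT⟩ := hCcov x
    exact (hΦ T T.card_le_univ).2 _ (hCt hT) x (hCU hT) j i hx.1 hx.2

theorem isomorphic_END [T2Space X] [ParacompactSpace X] (hH : ¬ FiniteDimensional ℂ H)
    [TopologicalSpace.SeparableSpace H] (hU : IsGoodCovering U)
    (E E' : TwistedHilbertBundle lam H) :
    (E.END hU.toIsOpenCovering).Isomorphic (E'.END hU.toIsOpenCovering) := by
  obtain ⟨h, hh, hE⟩ := exists_isomorphism hH hU E E'
  have hcomm : ∀ j i, ∀ x ∈ U i ∩ U j,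
      conj H (h j x) * conj H (E.g j i x) = conj H (E'.g j i x) * conj H (h i x) :=
    fun j i x hx => by rw [← map_mul, hE j i x hx, map_mul]
  refine ⟨fun b a x => conj H (E'.g b a x) * conj H (h a x), fun b a =>
    (continuousInPU_conj (E'.continuousOn b a)).mul
      (continuousInPU_conj ((hh a).mono inter_subset_left)), fun b' b a' a x hx => ?_⟩
  have h1 := (E'.END hU.toIsOpenCovering).cocycle b' b a x ⟨⟨hx.1.1, hx.2.1⟩, hx.2.2⟩
  have h2 := (E'.END hU.toIsOpenCovering).cocycle b' a' a x ⟨hx.1, hx.2.2⟩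
  change conj H (E'.g b' b x) * conj H (E'.g b a x) = conj H (E'.g b' a x) at h1
  change conj H (E'.g b' a' x) * conj H (E'.g a' a x) = conj H (E'.g b' a x) at h2
  change conj H (E'.g b' a' x) * conj H (h a' x) * conj H (E.g a' a x) =
    conj H (E'.g b' b x) * (conj H (E'.g b a x) * conj H (h a x))
  rw [mul_assoc, hcomm a' a x hx.1, ← mul_assoc, h2, ← mul_assoc, h1]

end Uniqueness

end TwistedHilbert

theorem theorem4p1
    {X : Type u} [TopologicalSpace X] [T2Space X] [ParacompactSpace X]
    {H : Type w} [NormedAddCommGroup H] [InnerProductSpace ℂ H] [CompleteSpace H]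
    [TopologicalSpace.SeparableSpace H] (hH : ¬ FiniteDimensional ℂ H)
    {ι : Type v} {U : ι → Set X} (hU : TwistedHilbert.IsGoodCovering U)
    (lam : TwistedHilbert.NormalizedCocycle U) :
    (∃ A : TwistedHilbert.AlgebraBundle.{u, v, w} X H, A.IsAssociatedTo lam) ∧
    (∀ (A B : TwistedHilbert.AlgebraBundle.{u, y, w} X H),
      A.IsAssociatedTo lam → B.IsAssociatedTo lam → A.Isomorphic B) ∧
    (∀ A : TwistedHilbert.AlgebraBundle.{u, y, w} X H, A.IsAssociatedTo lam →
      ∃ E : TwistedHilbert.TwistedHilbertBundle lam H,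
        A.Isomorphic (E.END hU.toIsOpenCovering)) := by
  have : Nontrivial H := by
    by_contra h
    have := not_nontrivial_iff_subsingleton.1 h
    exact hH inferInstance
  have := hU.finite
  refine ⟨TwistedHilbert.exists_associated hH hU.toIsOpenCovering lam, fun A B hA hB => ?_,
    TwistedHilbert.exists_isomorphic_END hU lam⟩
  obtain ⟨E, hE⟩ := TwistedHilbert.exists_isomorphic_END hU lam A hA
  obtain ⟨E', hE'⟩ := TwistedHilbert.exists_isomorphic_END hU lam B hB
  exact (hE.trans (TwistedHilbert.isomorphic_END hH hU E E')).trans hE'.symm
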